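/- Let $n\ge 1$ be an integer, $\hbar>0$ and $r\ge 0$. Write points of $\mathbb{R}^{2n}$ as $z=(x,p)$ with $x,p\in\mathbb{R}^n$, let $|\cdot|$ be the Euclidean (resp. Hermitian) norm, let $\sigma(z,z')=p\cdot x'-x\cdot p'$ be the standard symplectic form, and let $$a_\sigma(z)=\Big(\frac{1}{2\pi\hbar}\Big)^{n}\int_{\mathbb{R}^{2n}}e^{-\frac{i}{\hbar}\sigma(z,z')}a(z')\,dz'$$ be the symplectic Fourier transform, extended to tempered distributions by duality. Let $\Theta(x,p)=\frac{\sin(x\cdot p/2\hbar)}{x\cdot p/2\hbar}$ (with $\Theta(x,p)=1$ if $x\cdot p=0$), and let $\Theta_\sigma$ be the symplectic Fourier transform of $\Theta$; the convolution of any tempered distribution with $\Theta_\sigma$ is a well-defined tempered distribution. Let $\mathcal{A}_r$ be the space of smooth functions $a:\mathbb{R}^{2n}\to\mathbb{C}$ that extend to entire functions on $\mathbb{C}^{2n}$ satisfying $$|a(\zeta)|\le C(1+|\zeta|)^N\exp\Big(\frac{r}{\hbar}|\mathrm{Im}\,\zeta|\Big),\qquad \zeta\in\mathbb{C}^{2n},$$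 for some $C,N>0$; such functions are identified with the tempered distributions that they define. Then the map $$a\longmapsto \Big(\frac{1}{2\pi\hbar}\Big)^{n} a*\Theta_\sigma$$ sends $\mathcal{A}_r$ into $\mathcal{A}_r$, and it is a bijection of $\mathcal{A}_r$ onto itself if and only if $r<\sqrt{4\pi\hbar}$. Moreover, if $r\ge\sqrt{4\pi\hbar}$, it is not injective on $\mathcal{A}_r$. -/

import Mathlib

open scoped SchwartzMap

noncomputable section

namespace BornJordan

/-- Phase space `ℝ²ⁿ` with its Euclidean norm and Lebesgue measure: `z = (x, p)` has the position
coordinates `x i = z (Sum.inl i)` and the momentum coordinates `p i = z (Sum.inr i)`. -/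
abbrev Phase (n : ℕ) : Type := EuclideanSpace ℝ (Fin n ⊕ Fin n)

/-- The complexified phase space `ℂ²ⁿ` with its Hermitian norm. -/
abbrev CPhase (n : ℕ) : Type := EuclideanSpace ℂ (Fin n ⊕ Fin n)

/-- The inclusion `ℝ²ⁿ ⊆ ℂ²ⁿ`. -/
def toCPhase {n : ℕ} (z : Phase n) : CPhase n := WithLp.toLp 2 fun i => (z i : ℂ)

/-- The vector of imaginary parts of a point of `ℂ²ⁿ`. -/
def imPart {n : ℕ} (ζ : CPhase n) : Phase n := WithLp.toLp 2 fun i => (ζ i).im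

/-- The product `x · p` of the position and momentum parts of `z = (x, p)`. -/
def posDotMom {n : ℕ} (z : Phase n) : ℝ := ∑ i, z (Sum.inl i) * z (Sum.inr i)

/-- The standard symplectic form `σ(z, z') = p · x' - x · p'`. -/
def sympl {n : ℕ} (z z' : Phase n) : ℝ :=
  ∑ i, (z (Sum.inr i) * z' (Sum.inl i) - z (Sum.inl i) * z' (Sum.inr i))

/-- The linear isomorphism `J (x, p) = (p, -x)`, so that `σ(z, z') = J z · z'`. -/
def J (n : ℕ) : Phase n ≃ₗ[ℝ] Phase n where
  toFun z := WithLp.toLp 2 (Sum.elim (fun i => z (Sum.inr i)) (fun i => -z (Sum.inl i)))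
  invFun z := WithLp.toLp 2 (Sum.elim (fun i => -z (Sum.inr i)) (fun i => z (Sum.inl i)))
  map_add' z w := by ext (i | i) <;> simp; ring
  map_smul' c z := by ext (i | i) <;> simp
  left_inv z := by ext (i | i) <;> simp
  right_inv z := by ext (i | i) <;> simp

theorem inner_J {n : ℕ} (z z' : Phase n) : inner ℝ (J n z) z' = sympl z z' := by
  simp [J, sympl, PiLp.inner_apply, Fintype.sum_sum_type, Finset.sum_sub_distrib, mul_comm]
  ring

/-- The map `z ↦ (2πℏ)⁻¹ J z` as a continuous linear equivalence. -/
def scaledJ (n : ℕ) {ℏ : ℝ} (hℏ : 0 < ℏ) : Phase n ≃L[ℝ] Phase n :=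
  ((J n).trans (LinearEquiv.smulOfNeZero ℝ (Phase n) (2 * Real.pi * ℏ)⁻¹
    (by positivity))).toContinuousLinearEquiv

/-- The symplectic Fourier transform on Schwartz functions,
`F_σ φ(z) = (2πℏ)⁻ⁿ ∫ exp(-(i/ℏ) σ(z, z')) φ(z') dz'` (see `symplFourier_apply`). -/
def symplFourier (n : ℕ) {ℏ : ℝ} (hℏ : 0 < ℏ) : 𝓢(Phase n, ℂ) →L[ℂ] 𝓢(Phase n, ℂ) :=
  (((2 * Real.pi * ℏ : ℝ) : ℂ) ^ n)⁻¹ •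
    (SchwartzMap.compCLMOfContinuousLinearEquiv ℂ (scaledJ n hℏ) ∘L
      FourierTransform.fourierCLM ℂ 𝓢(Phase n, ℂ))

theorem symplFourier_apply {n : ℕ} {ℏ : ℝ} (hℏ : 0 < ℏ) (φ : 𝓢(Phase n, ℂ)) (z : Phase n) :
    symplFourier n hℏ φ z = (((2 * Real.pi * ℏ : ℝ) : ℂ) ^ n)⁻¹ *
      ∫ z', Complex.exp (-(Complex.I / ℏ) * sympl z z') * φ z' := by
  have h : symplFourier n hℏ φ z = (((2 * Real.pi * ℏ : ℝ) : ℂ) ^ n)⁻¹ *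
      (FourierTransform.fourier (φ : Phase n → ℂ)) ((2 * Real.pi * ℏ)⁻¹ • J n z) := rfl
  rw [h, Real.fourier_eq']
  congr 1
  refine MeasureTheory.integral_congr_ae (Filter.Eventually.of_forall fun z' => ?_)
  have h1 : (ℏ : ℂ) ≠ 0 := by exact_mod_cast hℏ.ne'
  have h2 : (Real.pi : ℂ) ≠ 0 := by exact_mod_cast Real.pi_ne_zero
  simp only [smul_eq_mul]
  rw [inner_smul_right, real_inner_comm, inner_J]
  congr 2
  push_cast
  field_simp

/-- Reflection `φ ↦ φ(-·)` of Schwartz functions. -/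
def reflect (n : ℕ) : 𝓢(Phase n, ℂ) →L[ℂ] 𝓢(Phase n, ℂ) :=
  SchwartzMap.compCLMOfContinuousLinearEquiv ℂ (ContinuousLinearEquiv.neg ℝ)

/-- The symplectic Fourier transform of a tempered distribution, by transposition. The kernel
`exp(-(i/ℏ) σ(z, z'))` is not symmetric: exchanging `z` and `z'` is a change of the sign of one of
them, so that the transpose of `F_σ` is `F_σ` followed by the reflection. -/
def distSymplFourier (n : ℕ) {ℏ : ℝ} (hℏ : 0 < ℏ) : 𝓢'(Phase n, ℂ) →L[ℂ] 𝓢'(Phase n, ℂ) :=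
  PointwiseConvergenceCLM.precomp ℂ (reflect n ∘L symplFourier n hℏ)

theorem distSymplFourier_apply {n : ℕ} {ℏ : ℝ} (hℏ : 0 < ℏ) (T : 𝓢'(Phase n, ℂ))
    (φ : 𝓢(Phase n, ℂ)) :
    distSymplFourier n hℏ T φ = T (reflect n (symplFourier n hℏ φ)) := rfl

/-- Cohen's kernel `Θ(x, p) = sin(x·p / 2ℏ) / (x·p / 2ℏ)`, equal to `1` where `x·p = 0`. -/
def theta (n : ℕ) (ℏ : ℝ) (z : Phase n) : ℂ := (Real.sinc (posDotMom z / (2 * ℏ)) : ℂ)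

theorem sinc_temperate : Function.HasTemperateGrowth (fun t : ℝ => (Real.sinc t : ℂ)) := by
  set μ : MeasureTheory.Measure ℝ := MeasureTheory.volume.restrict (Set.Icc (-1) 1) with hμ
  have hae : ∀ᵐ x ∂μ, ‖x‖ ≤ 1 := by
    filter_upwards [MeasureTheory.ae_restrict_mem measurableSet_Icc] with x hx
    exact abs_le.2 hx
  have hint : ∀ k : ℕ, MeasureTheory.MemLp id k μ := fun k =>
    MeasureTheory.MemLp.of_bound measurable_id.aestronglyMeasurable 1 hae
  have hs : (fun t : ℝ => (Real.sinc t : ℂ)) =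
      fun t => (2⁻¹ : ℂ) • MeasureTheory.charFun μ t := by
    funext t
    rw [MeasureTheory.charFun_apply_real, hμ, MeasureTheory.integral_Icc_eq_integral_Ioc,
      ← intervalIntegral.integral_of_le (by norm_num)]
    have h := integral_exp_mul_I_eq_sinc t
    by_cases ht : t = 0
    · subst ht
      simp
      norm_num
    · have hc := intervalIntegral.integral_comp_mul_left
        (a := -1) (b := 1) (fun x : ℝ => Complex.exp (x * Complex.I)) ht
      simp only [mul_neg, mul_one] at hc
      have htc : (t : ℂ) ≠ 0 := by exact_mod_cast ht
      push_cast at hc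
      rw [hc, h, Complex.real_smul, smul_eq_mul]
      push_cast
      field_simp
  have hb : ∀ t, ∀ k : ℕ, ‖iteratedDeriv k (MeasureTheory.charFun μ) t‖ ≤ μ.real Set.univ := by
    intro t k
    rw [MeasureTheory.iteratedDeriv_charFun (hint k), norm_mul, norm_pow, Complex.norm_I, one_pow,
      one_mul]
    refine (MeasureTheory.norm_integral_le_of_norm_le_const (C := 1) ?_).trans (by simp)
    filter_upwards [hae] with x hx
    have he : ‖Complex.exp (t * x * Complex.I)‖ = 1 := by
      have := Complex.norm_exp_ofReal_mul_I (t * x)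
      push_cast at this
      exact this
    rw [norm_mul, he, mul_one, norm_pow, Complex.norm_real]
    exact pow_le_one₀ (norm_nonneg _) hx
  have hc : Function.HasTemperateGrowth (MeasureTheory.charFun μ) := by
    refine ⟨MeasureTheory.contDiff_charFun' hint, fun k => ⟨0, μ.real Set.univ, fun t => ?_⟩⟩
    rw [norm_iteratedFDeriv_eq_norm_iteratedDeriv, pow_zero, mul_one]
    exact hb t k
  rw [hs]
  exact (Function.HasTemperateGrowth.const (2⁻¹ : ℂ)).smul hc

theorem posDotMom_temperate (n : ℕ) : Function.HasTemperateGrowth (posDotMom (n := n)) := by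
  unfold posDotMom
  refine Function.HasTemperateGrowth.sum fun i _ => ?_
  have h (j : Fin n ⊕ Fin n) : Function.HasTemperateGrowth (fun z : Phase n => z j) :=
    (EuclideanSpace.proj j : Phase n →L[ℝ] ℝ).hasTemperateGrowth
  exact (h _).mul (h _)

theorem theta_temperate (n : ℕ) (ℏ : ℝ) : Function.HasTemperateGrowth (theta n ℏ) := by
  have h : Function.HasTemperateGrowth (fun z : Phase n => posDotMom z / (2 * ℏ)) := by
    simp only [div_eq_mul_inv]
    exact (posDotMom_temperate n).mul (Function.HasTemperateGrowth.const _)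
  exact sinc_temperate.comp h

/-- `Θ` as a tempered distribution, `φ ↦ ∫ φ(z) Θ(z) dz`. -/
def thetaDist (n : ℕ) (ℏ : ℝ) : 𝓢'(Phase n, ℂ) :=
  (theta_temperate n ℏ).toTemperedDistribution MeasureTheory.volume

/-- The tempered distribution `Θ_σ`, the symplectic Fourier transform of `Θ`. -/
def thetaSigma (n : ℕ) {ℏ : ℝ} (hℏ : 0 < ℏ) : 𝓢'(Phase n, ℂ) :=
  distSymplFourier n hℏ (thetaDist n ℏ)

/-- `L` is the operator `φ ↦ (z ↦ ⟨T_w, φ(z + w)⟩)` on Schwartz functions. A tempered distribution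
`T` for which such an operator exists is a convolutor of tempered distributions. -/
def IsConvolutorBy {n : ℕ} (T : 𝓢'(Phase n, ℂ)) (L : 𝓢(Phase n, ℂ) →L[ℂ] 𝓢(Phase n, ℂ)) : Prop :=
  ∀ φ z, L φ z = T (SchwartzMap.compSubConstCLM ℂ (-z) φ)

open Classical in
/-- The convolution `a ∗ T` of a tempered distribution `a` with a convolutor `T`:
`⟨a ∗ T, φ⟩ = ⟨a_z, ⟨T_w, φ(z + w)⟩⟩`. It is set to be `0` if `T` is not a convolutor. -/
def conv {n : ℕ} (a T : 𝓢'(Phase n, ℂ)) : 𝓢'(Phase n, ℂ) :=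
  if h : ∃ L, IsConvolutorBy T L then PointwiseConvergenceCLM.precomp ℂ h.choose a else 0

theorem conv_apply {n : ℕ} (a T : 𝓢'(Phase n, ℂ)) {L : 𝓢(Phase n, ℂ) →L[ℂ] 𝓢(Phase n, ℂ)}
    (hL : IsConvolutorBy T L) (φ : 𝓢(Phase n, ℂ)) : conv a T φ = a (L φ) := by
  have h : ∃ L, IsConvolutorBy T L := ⟨L, hL⟩
  have h1 : conv a T φ = a (h.choose φ) := by
    rw [conv, dif_pos h]
    rfl
  have h2 : h.choose φ = L φ := by
    ext z
    rw [h.choose_spec φ z, hL φ z]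
  rw [h1, h2]

/-- `Θ_σ` is a convolutor, so that `a ∗ Θ_σ` is the genuine convolution for every tempered
distribution `a`. -/
theorem thetaSigma_isConvolutorBy (n : ℕ) {ℏ : ℝ} (hℏ : 0 < ℏ) :
    IsConvolutorBy (thetaSigma n hℏ) ((((2 * Real.pi * ℏ : ℝ) : ℂ) ^ n) •
      (symplFourier n hℏ ∘L SchwartzMap.smulLeftCLM ℂ (theta n ℏ) ∘L symplFourier n hℏ)) := by
  intro φ z
  have hc : (((2 * Real.pi * ℏ : ℝ) : ℂ) ^ n) ≠ 0 := by
    have : (0 : ℝ) < 2 * Real.pi * ℏ := by positivity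
    exact pow_ne_zero _ (by exact_mod_cast this.ne')
  have hL : ((((2 * Real.pi * ℏ : ℝ) : ℂ) ^ n) • (symplFourier n hℏ ∘L
      SchwartzMap.smulLeftCLM ℂ (theta n ℏ) ∘L symplFourier n hℏ)) φ z =
      (((2 * Real.pi * ℏ : ℝ) : ℂ) ^ n) * symplFourier n hℏ
        (SchwartzMap.smulLeftCLM ℂ (theta n ℏ) (symplFourier n hℏ φ)) z := rfl
  have hR : thetaSigma n hℏ (SchwartzMap.compSubConstCLM ℂ (-z) φ) =
      ∫ w, symplFourier n hℏ (SchwartzMap.compSubConstCLM ℂ (-z) φ) (-w) * theta n ℏ w := rfl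
  have neg_left : ∀ w u : Phase n, sympl (-w) u = -sympl w u := by
    intro w u
    rw [← inner_J, ← inner_J, map_neg, inner_neg_left]
  have sub_right : ∀ w u v : Phase n, sympl w (u - v) = sympl w u - sympl w v := by
    intro w u v
    simp only [← inner_J, inner_sub_right]
  have skew : ∀ w u : Phase n, sympl w u = -sympl u w := by
    intro w u
    simp only [sympl, ← Finset.sum_neg_distrib]
    exact Finset.sum_congr rfl fun i _ => by ring
  have htr : ∀ w : Phase n, symplFourier n hℏ (SchwartzMap.compSubConstCLM ℂ (-z) φ) w =
      Complex.exp (Complex.I / ℏ * sympl w z) * symplFourier n hℏ φ w := by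
    intro w
    rw [symplFourier_apply, symplFourier_apply, mul_left_comm]
    congr 1
    rw [← MeasureTheory.integral_const_mul,
      ← MeasureTheory.integral_sub_right_eq_self
        (fun u => Complex.exp (-(Complex.I / ℏ) * sympl w u) *
          (SchwartzMap.compSubConstCLM ℂ (-z) φ) u) z]
    refine MeasureTheory.integral_congr_ae (Filter.Eventually.of_forall fun u => ?_)
    simp only [SchwartzMap.compSubConstCLM_apply, sub_neg_eq_add, sub_add_cancel, sub_right]
    rw [← mul_assoc, ← Complex.exp_add]
    congr 2
    push_cast
    ring
  have heven : ∀ w : Phase n, theta n ℏ (-w) = theta n ℏ w := by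
    intro w
    simp [theta, posDotMom]
  rw [hL, hR, symplFourier_apply, mul_inv_cancel_left₀ hc]
  rw [← MeasureTheory.integral_neg_eq_self
    (fun w => symplFourier n hℏ (SchwartzMap.compSubConstCLM ℂ (-z) φ) (-w) * theta n ℏ w)]
  refine MeasureTheory.integral_congr_ae (Filter.Eventually.of_forall fun w => ?_)
  simp only [neg_neg, heven, htr, SchwartzMap.smulLeftCLM_apply_apply (theta_temperate n ℏ),
    smul_eq_mul]
  rw [skew w z]
  push_cast
  ring_nf

/-- The map `a ↦ (2πℏ)⁻ⁿ a ∗ Θ_σ` on tempered distributions, which sends a Born–Jordan symbol of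
an operator to its Weyl symbol. -/
def bornJordanToWeyl (n : ℕ) {ℏ : ℝ} (hℏ : 0 < ℏ) (a : 𝓢'(Phase n, ℂ)) : 𝓢'(Phase n, ℂ) :=
  (((2 * Real.pi * ℏ : ℝ) : ℂ) ^ n)⁻¹ • conv a (thetaSigma n hℏ)

/-- `a` is a smooth function on `ℝ²ⁿ` that extends to an entire function `f` on `ℂ²ⁿ` with
`|f(ζ)| ≤ C (1 + |ζ|)ᴺ exp((r/ℏ) |Im ζ|)` for some `C` and `N`. -/
def IsExpType (n : ℕ) (ℏ r : ℝ) (a : Phase n → ℂ) : Prop :=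
  ContDiff ℝ (⊤ : ℕ∞) a ∧ ∃ f : CPhase n → ℂ, Differentiable ℂ f ∧ (∀ z, f (toCPhase z) = a z) ∧
    ∃ C : ℝ, 0 < C ∧ ∃ N : ℕ, 0 < N ∧
      ∀ ζ, ‖f ζ‖ ≤ C * (1 + ‖ζ‖) ^ N * Real.exp (r / ℏ * ‖imPart ζ‖)

/-- The tempered distribution `T` is given by the function `a`. -/
def IsGivenBy {n : ℕ} (T : 𝓢'(Phase n, ℂ)) (a : Phase n → ℂ) : Prop :=
  ∀ φ : 𝓢(Phase n, ℂ), MeasureTheory.Integrable (fun z => a z * φ z) ∧ T φ = ∫ z, a z * φ z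

/-- The space `A_r`, as a subspace of the space of tempered distributions (a function is identified
with the distribution that it defines). -/
def expTypeSpace (n : ℕ) (ℏ r : ℝ) : Set 𝓢'(Phase n, ℂ) :=
  {T | ∃ a : Phase n → ℂ, IsExpType n ℏ r a ∧ IsGivenBy T a}

theorem norm_toCPhase {n : ℕ} (z : Phase n) : ‖toCPhase z‖ = ‖z‖ := by
  simp [EuclideanSpace.norm_eq, toCPhase]

/-- Every function in `A_r` does define a tempered distribution. -/
theorem IsExpType.exists_isGivenBy {n : ℕ} {ℏ r : ℝ} {a : Phase n → ℂ} (ha : IsExpType n ℏ r a) :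
    ∃ T : 𝓢'(Phase n, ℂ), IsGivenBy T a := by
  obtain ⟨hsm, f, -, hf, C, hC, N, -, hb⟩ := ha
  have hbd : ∀ z, ‖a z‖ ≤ C * (1 + ‖z‖) ^ N := by
    intro z
    have him : imPart (toCPhase z) = 0 := by
      ext i
      simp [imPart, toCPhase]
    have h := hb (toCPhase z)
    rwa [hf, norm_toCPhase, him, norm_zero, mul_zero, Real.exp_zero, mul_one] at h
  set g : Phase n → ℂ := fun z => (((1 + ‖z‖ ^ 2) ^ N : ℝ) : ℂ) with hg
  have hgt : g.HasTemperateGrowth := by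
    have h1 : Function.HasTemperateGrowth (fun z : Phase n => (1 + ‖z‖ ^ 2) ^ N) :=
      ((Function.HasTemperateGrowth.const (1 : ℝ)).add
        (Function.hasTemperateGrowth_norm_sq (H := Phase n))).pow N
    exact Function.HasTemperateGrowth.comp Function.Complex.hasTemperateGrowth_ofReal h1
  have hpos : ∀ z : Phase n, (0 : ℝ) < (1 + ‖z‖ ^ 2) ^ N := fun z => by positivity
  have hg0 : ∀ z, g z ≠ 0 := fun z => by
    simp only [hg]
    exact_mod_cast (hpos z).ne'
  have hmem : MeasureTheory.MemLp (fun z => (g z)⁻¹ * a z) ⊤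
      (MeasureTheory.volume : MeasureTheory.Measure (Phase n)) := by
    refine MeasureTheory.memLp_top_of_bound
      ((hgt.1.continuous.inv₀ hg0).mul hsm.continuous).aestronglyMeasurable (C * 2 ^ N)
      (Filter.Eventually.of_forall fun z => ?_)
    have hgn : ‖g z‖ = (1 + ‖z‖ ^ 2) ^ N := by
      simp only [hg, Complex.norm_real, Real.norm_eq_abs, abs_of_pos (hpos z)]
    rw [norm_mul, norm_inv, hgn, inv_mul_le_iff₀ (hpos z)]
    refine (hbd z).trans ?_
    have h2 : (1 + ‖z‖) ^ N ≤ (2 * (1 + ‖z‖ ^ 2)) ^ N := by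
      gcongr
      nlinarith [sq_nonneg (‖z‖ - 1), norm_nonneg z]
    calc C * (1 + ‖z‖) ^ N ≤ C * (2 * (1 + ‖z‖ ^ 2)) ^ N := by gcongr
      _ = (1 + ‖z‖ ^ 2) ^ N * (C * 2 ^ N) := by rw [mul_pow]; ring
  refine ⟨TemperedDistribution.smulLeftCLM ℂ g
    (MeasureTheory.Lp.toTemperedDistribution hmem.toLp), fun φ => ?_⟩
  have key : (fun z => (SchwartzMap.smulLeftCLM ℂ g φ) z • (hmem.toLp : Phase n → ℂ) z)
      =ᵐ[MeasureTheory.volume] fun z => a z * φ z := by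
    filter_upwards [hmem.coeFn_toLp] with z hz
    rw [hz, SchwartzMap.smulLeftCLM_apply_apply hgt, smul_eq_mul, smul_eq_mul]
    field_simp [hg0 z]
  refine ⟨?_, ?_⟩
  · have hi : MeasureTheory.Integrable (fun z => (SchwartzMap.smulLeftCLM ℂ g φ) z *
        ((g z)⁻¹ * a z)) := by
      have := MeasureTheory.MemLp.integrable_mul
        (p := 1) (q := ⊤) ((SchwartzMap.smulLeftCLM ℂ g φ).memLp 1) hmem
      exact this
    refine hi.congr (Filter.Eventually.of_forall fun z => ?_)
    simp only [SchwartzMap.smulLeftCLM_apply_apply hgt, smul_eq_mul]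
    field_simp [hg0 z]
  · rw [TemperedDistribution.smulLeftCLM_apply_apply,
      MeasureTheory.Lp.toTemperedDistribution_apply]
    exact MeasureTheory.integral_congr_ae key

end BornJordan

end

/-!
Write `F` for the symplectic Fourier transform, an involution (`symplFourier_symplFourier`). By
transposition, the map `a ↦ (2πℏ)⁻ⁿ a ∗ Θ_σ` sends a tempered distribution `T` to
`φ ↦ T (F (Θ · F φ))` (`bornJordanToWeyl_apply`): on the Fourier side it is multiplication by `Θ`.

Two facts about `A_r` carry the argument.

* If `a ∈ A_r`, then `F a` is supported in the closed ball of radius `r`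
  (`integral_mul_symplFourier_eq_zero`), so that `T (F ψ)` depends only on the values of `ψ` near
  that ball (`apply_symplFourier_congr`). For the proof, `a` is multiplied by `exp (-δ|z|²)`. A
  contour shift of length proportional to `1/δ` bounds the Fourier transform of the product at
  distance `ε` from the ball by a power of `1/δ` times `exp (-c ε²/δ)`, and `δ` tends to `0`.
* If `m` is a Schwartz function, then `T ↦ (φ ↦ T (F (m · F φ)))` maps `A_r` to itself
  (`mem_expTypeSpace_of_multiplier`). It is the convolution with the Schwartz function `F m` over
  the *real* points, and real translations do not change imaginary parts, so that the growth in the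
  imaginary directions is preserved. The sufficiency half of the Paley–Wiener–Schwartz theorem is
  thus not needed.

By the first fact `Θ` can be replaced by a cutoff of itself, and by the second `A_r` is mapped to
itself. Since `|x · p| ≤ |z|²/2`, the function `Θ` has no zero in the open ball of radius
`√(4πℏ)` (`theta_ne_zero`). If `r < √(4πℏ)`, then a cutoff of `1/Θ` is a Schwartz function which
inverts `Θ` near the closed ball of radius `r`, and its multiplier is the inverse of the map. If
`r ≥ √(4πℏ)`, then `Θ` vanishes at a point `z₀` with `|z₀| = √(4πℏ)` and `x · p = 2πℏ`, and the
plane wave `exp (-(i/ℏ) σ(z₀, z))`, whose Fourier transform is a point mass at `z₀`, is a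
nonzero element of `A_r` which is sent to `0`.
-/

open scoped SchwartzMap

noncomputable section

namespace BornJordan

open MeasureTheory Metric

/-! ### Entire functions of several variables -/

/-- Differentiation under the integral sign for holomorphic integrands: by the Cauchy estimates
(here in the form of the Schwarz lemma) a locally uniform integrable bound on the integrand itself
is enough. -/
theorem differentiable_integral_of_holomorphic {E X : Type*} [NormedAddCommGroup E]
    [NormedSpace ℂ E] [FiniteDimensional ℂ E] [TopologicalSpace X] [MeasurableSpace X]
    [BorelSpace X] [SecondCountableTopology X] {μ : Measure X} {F : E → X → ℂ}
    (hd : ∀ x, Differentiable ℂ fun ζ => F ζ x)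
    (hc : Continuous fun p : X × E => F p.2 p.1)
    (hb : ∀ R : ℝ, ∃ bound : X → ℝ, Integrable bound μ ∧
      ∀ ζ, ‖ζ‖ ≤ R → ∀ x, ‖F ζ x‖ ≤ bound x) :
    Differentiable ℂ fun ζ => ∫ x, F ζ x ∂μ := by
  intro ζ₀
  have : ProperSpace E := FiniteDimensional.proper ℂ E
  obtain ⟨bound, hint, hbd⟩ := hb (‖ζ₀‖ + 2)
  have hm : ∀ ζ, AEStronglyMeasurable (F ζ) μ := fun ζ =>
    (hc.comp (Continuous.prodMk_left ζ)).aestronglyMeasurable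
  have hm' : AEStronglyMeasurable (fun x => fderiv ℂ (fun ζ => F ζ x) ζ₀) μ := by
    borelize E
    have h := measurable_fderiv_with_param ℂ (f := fun (x : X) ζ => F ζ x) hc
    have h2 : Measurable fun x => fderiv ℂ (fun ζ => F ζ x) ζ₀ :=
      h.comp (measurable_id.prodMk measurable_const)
    exact h2.aestronglyMeasurable
  refine (hasFDerivAt_integral_of_dominated_of_fderiv_le
    (F' := fun ζ x => fderiv ℂ (fun ζ => F ζ x) ζ) (bound := fun x => 2 * bound x)
    (ball_mem_nhds ζ₀ one_pos) (Filter.Eventually.of_forall hm)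
    (hint.mono' (hm ζ₀) (Filter.Eventually.of_forall fun x => hbd ζ₀ (by linarith) x)) hm'
    (Filter.Eventually.of_forall fun x ζ hζ => ?_) (hint.const_mul 2)
    (Filter.Eventually.of_forall fun x ζ _ => (hd x ζ).hasFDerivAt)).differentiableAt
  have hn : ∀ w ∈ ball ζ 1, ‖w‖ ≤ ‖ζ₀‖ + 2 := by
    intro w hw
    have h1 := norm_le_norm_add_norm_sub' w ζ
    have h2 := norm_le_norm_add_norm_sub' ζ ζ₀
    rw [mem_ball, dist_eq_norm] at hw hζ
    linarith
  have h := Complex.norm_fderiv_le_div_of_mapsTo_ball (c := ζ) (R₁ := 1) (R₂ := 2 * bound x)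
    (hd x).differentiableOn (fun w hw => by
      rw [mem_closedBall, dist_eq_norm]
      have h1 := hbd w (hn w hw) x
      have h2 := hbd ζ (hn ζ (mem_ball_self one_pos)) x
      linarith [norm_sub_le (F w x) (F ζ x)]) one_pos
  simpa using h

/-- The directional derivatives of an entire function are entire, since they are given by Cauchy
integrals over unit circles. -/
theorem differentiable_fderiv_apply {E : Type*} [NormedAddCommGroup E] [NormedSpace ℂ E]
    [FiniteDimensional ℂ E] {f : E → ℂ} (hf : Differentiable ℂ f) (e : E) :
    Differentiable ℂ fun ζ => fderiv ℂ f ζ e := by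
  have : ProperSpace E := FiniteDimensional.proper ℂ E
  set F : E → ℝ → ℂ := fun ζ θ =>
    deriv (circleMap 0 1) θ * ((circleMap 0 1 θ ^ 2)⁻¹ * f (ζ + circleMap 0 1 θ • e)) with hF
  have hne : ∀ θ, circleMap 0 1 θ ≠ 0 := fun θ => circleMap_ne_center one_ne_zero
  have hn : ∀ θ, ‖circleMap 0 1 θ‖ = 1 := fun θ => by simp
  have hcauchy : ∀ ζ, fderiv ℂ f ζ e =
      (2 * Real.pi * Complex.I : ℂ)⁻¹ * ∫ θ in Set.Ioc 0 (2 * Real.pi), F ζ θ := by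
    intro ζ
    have hg : Differentiable ℂ fun s : ℂ => f (ζ + s • e) := by fun_prop
    have h1 : deriv (fun s : ℂ => f (ζ + s • e)) 0 = fderiv ℂ f ζ e := by
      have h2 : HasDerivAt (fun s : ℂ => ζ + s • e) e 0 := by
        simpa using ((hasDerivAt_id (0 : ℂ)).smul_const e).const_add ζ
      have h3 : HasFDerivAt f (fderiv ℂ f ζ) (ζ + (0 : ℂ) • e) := by
        simpa using (hf ζ).hasFDerivAt
      exact (h3.comp_hasDerivAt (0 : ℂ) h2).deriv
    rw [← h1, ← Complex.two_pi_I_inv_smul_circleIntegral_sub_sq_inv_smul_of_differentiable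
      isOpen_univ (Set.subset_univ (closedBall (0 : ℂ) 1)) hg.differentiableOn
      (mem_ball_self one_pos), circleIntegral,
      intervalIntegral.integral_of_le (by positivity)]
    simp [hF]
  have hcF : Continuous fun p : ℝ × E => F p.2 p.1 := by
    have h1 : Continuous fun p : ℝ × E => f (p.2 + circleMap 0 1 p.1 • e) :=
      hf.continuous.comp (by fun_prop)
    have h2 : Continuous fun p : ℝ × E => (circleMap 0 1 p.1 ^ 2)⁻¹ :=
      Continuous.inv₀ (by fun_prop) fun p => pow_ne_zero _ (hne p.1)
    have h3 : Continuous fun p : ℝ × E => circleMap 0 1 p.1 * Complex.I := by fun_prop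
    simp only [hF, deriv_circleMap]
    exact h3.mul (h2.mul h1)
  have hd : Differentiable ℂ fun ζ => ∫ θ in Set.Ioc 0 (2 * Real.pi), F ζ θ := by
    refine differentiable_integral_of_holomorphic (fun θ => ?_) hcF fun R => ?_
    · simp only [hF]
      fun_prop
    · obtain ⟨B, hB⟩ := (isCompact_closedBall (0 : E) (R + ‖e‖)).exists_bound_of_continuousOn
        hf.continuous.continuousOn
      refine ⟨fun _ => B, integrable_const _, fun ζ hζ θ => ?_⟩
      have hmem : ζ + circleMap 0 1 θ • e ∈ closedBall (0 : E) (R + ‖e‖) := by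
        rw [mem_closedBall_zero_iff]
        refine (norm_add_le _ _).trans ?_
        rw [norm_smul, hn, one_mul]
        linarith
      simpa [hF, deriv_circleMap] using hB _ hmem
  simp only [hcauchy]
  exact hd.const_mul _

/-- Entire functions of several variables are smooth. -/
theorem contDiff_of_entire {E : Type*} [NormedAddCommGroup E] [NormedSpace ℂ E]
    [FiniteDimensional ℂ E] {f : E → ℂ} (hf : Differentiable ℂ f) :
    ContDiff ℂ (⊤ : ℕ∞) f := by
  refine contDiff_infty.2 fun k => ?_
  induction k generalizing f with
  | zero => exact contDiff_zero.2 hf.continuous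
  | succ k ih =>
    push_cast
    exact contDiff_succ_iff_fderiv_apply.2 ⟨hf, by simp, fun y =>
      ih (differentiable_fderiv_apply hf y)⟩

/-! ### Contour shifts -/

theorem continuous_toCPhase {n : ℕ} : Continuous (toCPhase (n := n)) := by
  unfold toCPhase
  fun_prop

/-- If `x ↦ g (x + w u)` is dominated, locally uniformly in `w : ℂ`, then its integral does not
depend on `w`: it is an entire function of `w`, and constant on the real axis by translation
invariance of the Lebesgue measure. -/
theorem integral_shift_eq {n : ℕ} {g : CPhase n → ℂ} (hg : Differentiable ℂ g) (u : Phase n)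
    (hb : ∀ R : ℝ, ∃ bound : Phase n → ℝ, Integrable bound ∧
      ∀ w : ℂ, ‖w‖ ≤ R → ∀ x, ‖g (toCPhase x + w • toCPhase u)‖ ≤ bound x) (w : ℂ) :
    ∫ x, g (toCPhase x + w • toCPhase u) = ∫ x, g (toCPhase x) := by
  have hcont := continuous_toCPhase (n := n)
  have hd : Differentiable ℂ fun w : ℂ => ∫ x, g (toCPhase x + w • toCPhase u) := by
    refine differentiable_integral_of_holomorphic (fun x => ?_) ?_ hb
    · fun_prop
    · exact hg.continuous.comp (by fun_prop)
  have hreal : ∀ s : ℝ, ∫ x, g (toCPhase x + (s : ℂ) • toCPhase u) = ∫ x, g (toCPhase x) := by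
    intro s
    rw [← integral_add_right_eq_self (fun x => g (toCPhase x)) (s • u)]
    congr 1
    funext x
    congr 1
    ext i
    simp [toCPhase]
  have hA : AnalyticOnNhd ℂ (fun w : ℂ => ∫ x, g (toCPhase x + w • toCPhase u)) Set.univ :=
    Complex.analyticOnNhd_univ_iff_differentiable.2 hd
  have hfreq : ∃ᶠ w in nhdsWithin (0 : ℂ) {0}ᶜ,
      ∫ x, g (toCPhase x + w • toCPhase u) = ∫ x, g (toCPhase x) := by
    have ht : Filter.Tendsto (fun s : ℝ => (s : ℂ)) (nhdsWithin 0 {0}ᶜ)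
        (nhdsWithin (0 : ℂ) {0}ᶜ) := by
      refine tendsto_nhdsWithin_iff.2 ⟨?_, ?_⟩
      · have := Complex.continuous_ofReal.tendsto 0
        exact (this.mono_left nhdsWithin_le_nhds).trans (by simp)
      · filter_upwards [self_mem_nhdsWithin] with s hs
        simpa using hs
    exact ht.frequently (Filter.Frequently.of_forall hreal)
  exact congrFun (hA.eq_of_frequently_eq analyticOnNhd_const hfreq) w

/-! ### Bilinear extensions to complex phase space and Gaussian weights -/

/-- The complex bilinear product `v · ζ` of a real and a complex vector. -/
def cdot {n : ℕ} (v : Phase n) (ζ : CPhase n) : ℂ := ∑ j, (v j : ℂ) * ζ j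

/-- The holomorphic quadratic form `∑ ζⱼ²`, which extends `‖x‖²` from `ℝ²ⁿ` to `ℂ²ⁿ`. -/
def sqSum {n : ℕ} (ζ : CPhase n) : ℂ := ∑ j, ζ j ^ 2

theorem cdot_toCPhase {n : ℕ} (v x : Phase n) : cdot v (toCPhase x) = (inner ℝ v x : ℝ) := by
  simp [cdot, toCPhase, PiLp.inner_apply, mul_comm]

theorem sqSum_toCPhase {n : ℕ} (x : Phase n) : sqSum (toCPhase x) = ((‖x‖ ^ 2 : ℝ) : ℂ) := by
  simp [sqSum, toCPhase, EuclideanSpace.norm_sq_eq]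

theorem im_cdot {n : ℕ} (v : Phase n) (ζ : CPhase n) :
    (cdot v ζ).im = inner ℝ v (imPart ζ) := by
  simp [cdot, imPart, PiLp.inner_apply, mul_comm]

theorem re_sqSum {n : ℕ} (ζ : CPhase n) :
    (sqSum ζ).re = ‖ζ‖ ^ 2 - 2 * ‖imPart ζ‖ ^ 2 := by
  simp only [sqSum, EuclideanSpace.norm_sq_eq, imPart, Complex.re_sum, Finset.mul_sum,
    ← Finset.sum_sub_distrib]
  refine Finset.sum_congr rfl fun j _ => ?_
  rw [Complex.sq_norm, Complex.normSq_apply, Real.norm_eq_abs, sq_abs, sq, Complex.mul_re]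
  ring

theorem differentiable_cdot {n : ℕ} (v : Phase n) : Differentiable ℂ (cdot v) := by
  have h : ∀ j, Differentiable ℂ fun ζ : CPhase n => ζ j := fun j =>
    (EuclideanSpace.proj j : CPhase n →L[ℂ] ℂ).differentiable
  unfold cdot
  fun_prop

theorem differentiable_sqSum {n : ℕ} : Differentiable ℂ (sqSum (n := n)) := by
  have h : ∀ j, Differentiable ℂ fun ζ : CPhase n => ζ j := fun j =>
    (EuclideanSpace.proj j : CPhase n →L[ℂ] ℂ).differentiable
  unfold sqSum
  fun_prop

theorem imPart_toCPhase_add_smul {n : ℕ} (x u : Phase n) (w : ℂ) :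
    imPart (toCPhase x + w • toCPhase u) = w.im • u := by
  ext j
  simp [imPart, toCPhase]

theorem norm_le_norm_toCPhase_add_I_smul {n : ℕ} (x u : Phase n) (t : ℝ) :
    ‖x‖ ≤ ‖toCPhase x + ((t : ℂ) * Complex.I) • toCPhase u‖ := by
  rw [EuclideanSpace.norm_eq, EuclideanSpace.norm_eq]
  refine Real.sqrt_le_sqrt (Finset.sum_le_sum fun j _ => ?_)
  rw [Complex.sq_norm, Complex.normSq_apply, Real.norm_eq_abs, sq_abs]
  simp [toCPhase]
  nlinarith [sq_nonneg (t * u j)]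

theorem one_add_pow_mul_exp_neg_le {δ s : ℝ} (hδ : 0 < δ) (hδ1 : δ ≤ 1) (hs : 0 ≤ s) (M : ℕ) :
    (1 + s) ^ M * Real.exp (-δ * s ^ 2) ≤ 2 ^ M * M.factorial * Real.exp 1 * (δ⁻¹) ^ M := by
  have h1 : (1 + s) ^ M ≤ (2 * (1 + s ^ 2)) ^ M := by
    gcongr
    nlinarith [sq_nonneg (s - 1)]
  have h2 : (δ * (1 + s ^ 2)) ^ M / M.factorial ≤ Real.exp (δ * (1 + s ^ 2)) :=
    Real.pow_div_factorial_le_exp _ (by positivity) M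
  have h3 : (1 + s ^ 2) ^ M ≤ (δ⁻¹) ^ M * M.factorial * Real.exp (δ * (1 + s ^ 2)) := by
    have hf : (0 : ℝ) < M.factorial := by positivity
    rw [div_le_iff₀ hf, mul_pow] at h2
    calc (1 + s ^ 2) ^ M = (δ⁻¹) ^ M * (δ ^ M * (1 + s ^ 2) ^ M) := by
          rw [← mul_assoc, ← mul_pow, inv_mul_cancel₀ hδ.ne', one_pow, one_mul]
      _ ≤ (δ⁻¹) ^ M * (Real.exp (δ * (1 + s ^ 2)) * M.factorial) := by gcongr
      _ = _ := by ring
  calc (1 + s) ^ M * Real.exp (-δ * s ^ 2)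
      ≤ (2 ^ M * ((δ⁻¹) ^ M * M.factorial * Real.exp (δ * (1 + s ^ 2)))) *
          Real.exp (-δ * s ^ 2) := by
        rw [mul_pow] at h1
        gcongr
        exact h1.trans (by gcongr)
    _ = 2 ^ M * M.factorial * (δ⁻¹) ^ M *
          (Real.exp (δ * (1 + s ^ 2)) * Real.exp (-δ * s ^ 2)) := by ring
    _ = 2 ^ M * M.factorial * (δ⁻¹) ^ M * Real.exp δ := by
        rw [← Real.exp_add]
        ring_nf
    _ ≤ 2 ^ M * M.factorial * (δ⁻¹) ^ M * Real.exp 1 := by gcongr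
    _ = _ := by ring

/-- The weight exponent `2n + 1` makes `(1 + ‖x‖)⁻⁽²ⁿ⁺¹⁾` integrable over `ℝ²ⁿ`. -/
theorem integrable_weight (n : ℕ) :
    Integrable fun x : Phase n => ((1 + ‖x‖) ^ (2 * n + 1))⁻¹ := by
  have h := integrable_one_add_norm (E := Phase n) (μ := volume) (r := ((2 * n + 1 : ℕ) : ℝ))
    (by
      simp only [finrank_euclideanSpace, Fintype.card_sum, Fintype.card_fin]
      push_cast
      linarith)
  refine h.congr (Filter.Eventually.of_forall fun x => ?_)
  simp only
  rw [Real.rpow_neg (by positivity), Real.rpow_natCast]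

/-! ### Fourier transforms of Gaussian regularizations -/

/-- The Gaussian regularization of `f(ζ) exp(-i v · ζ)`. -/
def gaussTwist {n : ℕ} (f : CPhase n → ℂ) (v : Phase n) (δ : ℝ) (ζ : CPhase n) : ℂ :=
  f ζ * Complex.exp (-δ * sqSum ζ - Complex.I * cdot v ζ)

theorem norm_gaussTwist_le {n : ℕ} {f : CPhase n → ℂ} {C ρ : ℝ} {N : ℕ} (hC : 0 < C)
    (hb : ∀ ζ, ‖f ζ‖ ≤ C * (1 + ‖ζ‖) ^ N * Real.exp (ρ * ‖imPart ζ‖))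
    (v : Phase n) {δ : ℝ} (hδ : 0 < δ) (hδ1 : δ ≤ 1) (D : ℕ) (ζ : CPhase n) :
    ‖gaussTwist f v δ ζ‖ ≤
      C * (2 ^ (N + D) * (N + D).factorial * Real.exp 1 * (δ⁻¹) ^ (N + D)) *
      Real.exp (ρ * ‖imPart ζ‖ + inner ℝ v (imPart ζ) + 2 * δ * ‖imPart ζ‖ ^ 2) *
      ((1 + ‖ζ‖) ^ D)⁻¹ := by
  have hre : (-δ * sqSum ζ - Complex.I * cdot v ζ).re =
      -δ * ‖ζ‖ ^ 2 + (2 * δ * ‖imPart ζ‖ ^ 2 + inner ℝ v (imPart ζ)) := by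
    have h1 := re_sqSum ζ
    have h2 := im_cdot v ζ
    simp only [Complex.sub_re, Complex.mul_re, Complex.neg_re, Complex.ofReal_re, Complex.neg_im,
      Complex.ofReal_im, Complex.I_re, Complex.I_im, h1, h2]
    ring
  have hpos : 0 < (1 + ‖ζ‖) ^ D := by positivity
  rw [← div_eq_mul_inv, le_div_iff₀ hpos, gaussTwist, norm_mul, Complex.norm_exp, hre,
    Real.exp_add]
  have hg := one_add_pow_mul_exp_neg_le hδ hδ1 (norm_nonneg ζ) (N + D)
  calc ‖f ζ‖ * (Real.exp (-δ * ‖ζ‖ ^ 2) *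
        Real.exp (2 * δ * ‖imPart ζ‖ ^ 2 + inner ℝ v (imPart ζ))) * (1 + ‖ζ‖) ^ D
      ≤ (C * (1 + ‖ζ‖) ^ N * Real.exp (ρ * ‖imPart ζ‖)) * (Real.exp (-δ * ‖ζ‖ ^ 2) *
        Real.exp (2 * δ * ‖imPart ζ‖ ^ 2 + inner ℝ v (imPart ζ))) * (1 + ‖ζ‖) ^ D := by
        gcongr
        exact hb ζ
    _ = C * ((1 + ‖ζ‖) ^ (N + D) * Real.exp (-δ * ‖ζ‖ ^ 2)) *
        Real.exp (ρ * ‖imPart ζ‖ + inner ℝ v (imPart ζ) + 2 * δ * ‖imPart ζ‖ ^ 2) := by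
        rw [show ρ * ‖imPart ζ‖ + inner ℝ v (imPart ζ) + 2 * δ * ‖imPart ζ‖ ^ 2 =
          ρ * ‖imPart ζ‖ + (2 * δ * ‖imPart ζ‖ ^ 2 + inner ℝ v (imPart ζ)) by ring,
          Real.exp_add (ρ * ‖imPart ζ‖), pow_add]
        ring
    _ ≤ _ := by gcongr

/-- Outside the ball of radius `ρ + ε` the Fourier transform of the Gaussian regularization of a
function of exponential type `ρ` is `O(δ⁻ᴹ exp(-ε² / 8δ))`. -/
theorem norm_integral_gaussTwist_le {n : ℕ} {f : CPhase n → ℂ} {C ρ : ℝ} {N : ℕ} (hC : 0 < C)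
    (hρ : 0 ≤ ρ) (hf : Differentiable ℂ f)
    (hb : ∀ ζ, ‖f ζ‖ ≤ C * (1 + ‖ζ‖) ^ N * Real.exp (ρ * ‖imPart ζ‖))
    {v : Phase n} {ε : ℝ} (hε : 0 < ε) (hv : ρ + ε ≤ ‖v‖) {δ : ℝ} (hδ : 0 < δ) (hδ1 : δ ≤ 1) :
    ‖∫ x, gaussTwist f v δ (toCPhase x)‖ ≤
      C * (2 ^ (N + (2 * n + 1)) * (N + (2 * n + 1)).factorial * Real.exp 1 *
        (δ⁻¹) ^ (N + (2 * n + 1))) *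
      Real.exp (-(ε ^ 2 / 8) * δ⁻¹) * ∫ x : Phase n, ((1 + ‖x‖) ^ (2 * n + 1))⁻¹ := by
  set K := C * (2 ^ (N + (2 * n + 1)) * (N + (2 * n + 1)).factorial * Real.exp 1 *
        (δ⁻¹) ^ (N + (2 * n + 1))) with hK
  have hK0 : 0 ≤ K := by positivity
  have hv0 : 0 < ‖v‖ := by linarith
  set u : Phase n := ‖v‖⁻¹ • v with hu
  have hu1 : ‖u‖ = 1 := by rw [hu, norm_smul, norm_inv, norm_norm, inv_mul_cancel₀ hv0.ne']
  have huv : inner ℝ v u = ‖v‖ := by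
    rw [hu, real_inner_smul_right, real_inner_self_eq_norm_sq]
    field_simp
  have hbound := norm_gaussTwist_le hC hb v hδ hδ1 (2 * n + 1)
  have hG : Differentiable ℂ (gaussTwist f v δ) := by
    have h1 := differentiable_cdot v
    have h2 := differentiable_sqSum (n := n)
    unfold gaussTwist
    fun_prop
  have hdom : ∀ R : ℝ, ∃ bound : Phase n → ℝ, Integrable bound ∧ ∀ w : ℂ, ‖w‖ ≤ R →
      ∀ x, ‖gaussTwist f v δ (toCPhase x + w • toCPhase u)‖ ≤ bound x := by
    intro R
    refine ⟨fun x => K * Real.exp (ρ * R + ‖v‖ * R + 2 * δ * R ^ 2) * (1 + R) ^ (2 * n + 1) *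
      ((1 + ‖x‖) ^ (2 * n + 1))⁻¹, (integrable_weight n).const_mul _, fun w hw x => ?_⟩
    have hR : 0 ≤ R := (norm_nonneg w).trans hw
    set ζ := toCPhase x + w • toCPhase u with hζ
    have him : ‖imPart ζ‖ ≤ R := by
      rw [hζ, imPart_toCPhase_add_smul, norm_smul, hu1, mul_one]
      exact (Complex.abs_im_le_norm w).trans hw
    have hin : inner ℝ v (imPart ζ) ≤ ‖v‖ * R :=
      (real_inner_le_norm _ _).trans (by gcongr)
    have hxζ : 1 + ‖x‖ ≤ (1 + R) * (1 + ‖ζ‖) := by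
      have h1 : ‖toCPhase x‖ ≤ ‖ζ‖ + ‖w • toCPhase u‖ := by
        have := norm_sub_le ζ (w • toCPhase u)
        rwa [hζ, add_sub_cancel_right] at this
      rw [norm_smul, norm_toCPhase, norm_toCPhase, hu1, mul_one] at h1
      nlinarith [norm_nonneg ζ]
    have hinv : ((1 + ‖ζ‖) ^ (2 * n + 1))⁻¹ ≤
        (1 + R) ^ (2 * n + 1) * ((1 + ‖x‖) ^ (2 * n + 1))⁻¹ := by
      rw [← div_eq_mul_inv, le_div_iff₀ (by positivity), inv_mul_le_iff₀ (by positivity),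
        mul_comm, ← mul_pow]
      exact pow_le_pow_left₀ (by positivity) (by linarith) _
    calc ‖gaussTwist f v δ ζ‖ ≤ _ := hbound ζ
      _ ≤ K * Real.exp (ρ * R + ‖v‖ * R + 2 * δ * R ^ 2) *
          ((1 + R) ^ (2 * n + 1) * ((1 + ‖x‖) ^ (2 * n + 1))⁻¹) := by gcongr
      _ = _ := by ring
  -- The shift by `-i t u` with `t = ε / 4δ` minimizes `2δt² - εt`.
  rw [← integral_shift_eq hG u hdom (((-(ε / (4 * δ)) : ℝ) : ℂ) * Complex.I),
    ← integral_const_mul]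
  refine norm_integral_le_of_norm_le ((integrable_weight n).const_mul _)
    (Filter.Eventually.of_forall fun x => ?_)
  set ζ := toCPhase x + (((-(ε / (4 * δ)) : ℝ) : ℂ) * Complex.I) • toCPhase u with hζ
  have him : imPart ζ = (-(ε / (4 * δ))) • u := by
    rw [hζ, imPart_toCPhase_add_smul]
    congr 1
    simp only [Complex.mul_im, Complex.ofReal_re, Complex.ofReal_im, Complex.I_im, Complex.I_re]
    ring
  have hn : ‖imPart ζ‖ = ε / (4 * δ) := by
    rw [him, norm_smul, hu1, mul_one, norm_neg, Real.norm_of_nonneg (by positivity)]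
  have hx : ‖x‖ ≤ ‖ζ‖ := norm_le_norm_toCPhase_add_I_smul x u _
  refine (hbound ζ).trans ?_
  rw [← hK, hn, him, real_inner_smul_right, huv]
  have hexp : ρ * (ε / (4 * δ)) + -(ε / (4 * δ)) * ‖v‖ + 2 * δ * (ε / (4 * δ)) ^ 2 ≤
      -(ε ^ 2 / 8) * δ⁻¹ := by
    have h1 : (ε / (4 * δ)) * (ρ + ε) ≤ (ε / (4 * δ)) * ‖v‖ := by gcongr
    have h2 : 2 * δ * (ε / (4 * δ)) ^ 2 - (ε / (4 * δ)) * ε = -(ε ^ 2 / 8) * δ⁻¹ := by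
      field_simp
      ring
    linarith
  gcongr

/-! ### Supports of symplectic Fourier transforms -/

theorem continuous_sympl {n : ℕ} : Continuous fun p : Phase n × Phase n => sympl p.1 p.2 := by
  unfold sympl
  fun_prop

theorem sympl_swap {n : ℕ} (z w : Phase n) : sympl z w = -sympl w z := by
  simp only [sympl, ← Finset.sum_neg_distrib]
  exact Finset.sum_congr rfl fun i _ => by ring

theorem norm_exp_sympl {n : ℕ} (ℏ : ℝ) (z w : Phase n) :
    ‖Complex.exp (-(Complex.I / ℏ) * sympl z w)‖ = 1 := by
  rw [show -(Complex.I / ℏ) * sympl z w = ((-(ℏ⁻¹ * sympl z w) : ℝ) : ℂ) * Complex.I by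
    push_cast; ring]
  exact Complex.norm_exp_ofReal_mul_I _

/-- Fubini's theorem for the symplectic Fourier transform. The kernel is skew: the sign of the
phase changes. -/
theorem integral_mul_symplFourier {n : ℕ} {ℏ : ℝ} (hℏ : 0 < ℏ) {g : Phase n → ℂ}
    (hg : Integrable g) (φ : 𝓢(Phase n, ℂ)) :
    ∫ z, g z * symplFourier n hℏ φ z = ∫ w, φ w * ((((2 * Real.pi * ℏ : ℝ) : ℂ) ^ n)⁻¹ *
      ∫ z, g z * Complex.exp (-(Complex.I / ℏ) * sympl z w)) := by
  have hint : Integrable (Function.uncurry fun z w : Phase n =>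
      (((2 * Real.pi * ℏ : ℝ) : ℂ) ^ n)⁻¹ *
        (g z * φ w * Complex.exp (-(Complex.I / ℏ) * sympl z w))) (volume.prod volume) := by
    refine Integrable.const_mul ?_ _
    refine (hg.mul_prod φ.integrable).mul_bdd (c := 1) ?_
      (Filter.Eventually.of_forall fun p => (norm_exp_sympl ℏ p.1 p.2).le)
    have := continuous_sympl (n := n)
    exact Continuous.aestronglyMeasurable (by fun_prop)
  calc ∫ z, g z * symplFourier n hℏ φ z
      = ∫ z, ∫ w, (((2 * Real.pi * ℏ : ℝ) : ℂ) ^ n)⁻¹ *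
        (g z * φ w * Complex.exp (-(Complex.I / ℏ) * sympl z w)) := by
        refine integral_congr_ae (Filter.Eventually.of_forall fun z => ?_)
        simp only [symplFourier_apply, ← integral_const_mul]
        exact integral_congr_ae (Filter.Eventually.of_forall fun w => by ring)
    _ = ∫ w, ∫ z, (((2 * Real.pi * ℏ : ℝ) : ℂ) ^ n)⁻¹ *
        (g z * φ w * Complex.exp (-(Complex.I / ℏ) * sympl z w)) := integral_integral_swap hint
    _ = _ := by
        refine integral_congr_ae (Filter.Eventually.of_forall fun w => ?_)
        simp only [← integral_const_mul]
        exact integral_congr_ae (Filter.Eventually.of_forall fun z => by ring)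

theorem norm_J {n : ℕ} (z : Phase n) : ‖J n z‖ = ‖z‖ := by
  rw [EuclideanSpace.norm_eq, EuclideanSpace.norm_eq]
  simp [J, Fintype.sum_sum_type, add_comm]

/-- The necessity half of the Paley–Wiener–Schwartz theorem: the symplectic Fourier transform of a
function in `A_r` vanishes outside the closed ball of radius `r`. -/
theorem integral_mul_symplFourier_eq_zero {n : ℕ} {ℏ : ℝ} (hℏ : 0 < ℏ) {r : ℝ} (hr : 0 ≤ r)
    {a : Phase n → ℂ} (ha : IsExpType n ℏ r a) {ε : ℝ} (hε : 0 < ε) {φ : 𝓢(Phase n, ℂ)}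
    (hφ : ∀ w, ‖w‖ ≤ r + ε → φ w = 0)
    (hint : Integrable fun z => a z * symplFourier n hℏ φ z) :
    ∫ z, a z * symplFourier n hℏ φ z = 0 := by
  obtain ⟨hsm, f, hf, hfa, C, hC, N, -, hb⟩ := ha
  set δ : ℕ → ℝ := fun k => ((k : ℝ) + 1)⁻¹ with hδ
  have hδ0 : ∀ k, 0 < δ k := fun k => by positivity
  have hδ1 : ∀ k, δ k ≤ 1 := fun k => inv_le_one_of_one_le₀ (by simp)
  have hδt : Filter.Tendsto δ Filter.atTop (nhds 0) := by
    simpa [hδ] using tendsto_one_div_add_atTop_nhds_zero_nat (𝕜 := ℝ)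
  set g : ℕ → Phase n → ℂ := fun k z => a z * (Real.exp (-δ k * ‖z‖ ^ 2) : ℂ) with hgdef
  have hgauss : ∀ (k : ℕ) (w z : Phase n), g k z * Complex.exp (-(Complex.I / ℏ) * sympl z w) =
      gaussTwist f (-(ℏ⁻¹ • J n w)) (δ k) (toCPhase z) := by
    intro k w z
    rw [gaussTwist, hfa, cdot_toCPhase, sqSum_toCPhase, sympl_swap, inner_neg_left,
      real_inner_smul_left, inner_J]
    simp only [hgdef]
    rw [Complex.ofReal_exp, mul_assoc, ← Complex.exp_add]
    congr 2
    push_cast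
    ring
  have hgint : ∀ k, Integrable (g k) := by
    intro k
    have hmeas : AEStronglyMeasurable (g k) volume := by
      have := hsm.continuous
      exact Continuous.aestronglyMeasurable (by fun_prop)
    have hle : ∀ z, ‖g k z‖ ≤ C * (2 ^ (N + (2 * n + 1)) * (N + (2 * n + 1)).factorial *
        Real.exp 1 * ((δ k)⁻¹) ^ (N + (2 * n + 1))) * ((1 + ‖z‖) ^ (2 * n + 1))⁻¹ := by
      intro z
      have h := norm_gaussTwist_le hC hb (-(ℏ⁻¹ • J n (0 : Phase n))) (hδ0 k) (hδ1 k)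
        (2 * n + 1) (toCPhase z)
      rw [← hgauss k 0 z, norm_mul, norm_exp_sympl, mul_one, norm_toCPhase,
        show imPart (toCPhase z) = 0 by ext i; simp [imPart, toCPhase]] at h
      simpa using h
    exact ((integrable_weight n).const_mul _).mono' hmeas (Filter.Eventually.of_forall hle)
  have hlim1 : Filter.Tendsto (fun k => ∫ z, g k z * symplFourier n hℏ φ z) Filter.atTop
      (nhds (∫ z, a z * symplFourier n hℏ φ z)) := by
    refine tendsto_integral_of_dominated_convergence (fun z => ‖a z * symplFourier n hℏ φ z‖)
      (fun k => ((hgint k).aestronglyMeasurable.mul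
        (symplFourier n hℏ φ).continuous.aestronglyMeasurable)) hint.norm
      (fun k => Filter.Eventually.of_forall fun z => ?_)
      (Filter.Eventually.of_forall fun z => ?_)
    · simp only [hgdef]
      rw [norm_mul, norm_mul, norm_mul, Complex.norm_real, Real.norm_of_nonneg (Real.exp_nonneg _)]
      have : Real.exp (-δ k * ‖z‖ ^ 2) ≤ 1 := by
        rw [Real.exp_le_one_iff]
        nlinarith [hδ0 k, sq_nonneg ‖z‖]
      gcongr
      exact mul_le_of_le_one_right (norm_nonneg _) this
    · have h1 : Filter.Tendsto (fun k => (Real.exp (-δ k * ‖z‖ ^ 2) : ℂ)) Filter.atTop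
          (nhds ((Real.exp (-0 * ‖z‖ ^ 2) : ℝ) : ℂ)) :=
        (Complex.continuous_ofReal.tendsto _).comp
          ((Real.continuous_exp.tendsto _).comp (hδt.neg.mul_const _))
      have h2 := (h1.const_mul (a z)).mul_const (symplFourier n hℏ φ z)
      simpa [hgdef] using h2
  set M := N + (2 * n + 1) with hM
  set A : ℝ := ∫ x : Phase n, ((1 + ‖x‖) ^ (2 * n + 1))⁻¹ with hA
  set B : ℕ → ℝ := fun k => C * (2 ^ M * M.factorial * Real.exp 1 * ((δ k)⁻¹) ^ M) *
      Real.exp (-((ε / ℏ) ^ 2 / 8) * (δ k)⁻¹) * A with hB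
  have hBlim : Filter.Tendsto B Filter.atTop (nhds 0) := by
    have hb0 : 0 < (ε / ℏ) ^ 2 / 8 := by positivity
    have h0 := ((Real.tendsto_pow_mul_exp_neg_atTop_nhds_zero M).comp
      (Filter.tendsto_id.const_mul_atTop hb0)).const_mul (((ε / ℏ) ^ 2 / 8) ^ M)⁻¹
    have h1 : Filter.Tendsto (fun x : ℝ => x ^ M * Real.exp (-((ε / ℏ) ^ 2 / 8) * x))
        Filter.atTop (nhds 0) := by
      rw [mul_zero] at h0
      refine h0.congr fun x => ?_
      simp only [Function.comp, id, mul_pow, neg_mul]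
      rw [← mul_assoc, ← mul_assoc, inv_mul_cancel₀ (pow_ne_zero _ hb0.ne'), one_mul]
    have h2 : Filter.Tendsto (fun k : ℕ => (δ k)⁻¹) Filter.atTop Filter.atTop := by
      simp only [hδ, inv_inv]
      exact Filter.tendsto_atTop_add_const_right _ _ tendsto_natCast_atTop_atTop
    have h3 := ((h1.comp h2).const_mul (C * (2 ^ M * M.factorial * Real.exp 1) * A))
    rw [mul_zero] at h3
    refine h3.congr fun k => ?_
    simp only [hB, Function.comp]
    ring
  have hle : ∀ k, ‖∫ z, g k z * symplFourier n hℏ φ z‖ ≤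
      (∫ w, ‖φ w‖) * (‖(((2 * Real.pi * ℏ : ℝ) : ℂ) ^ n)⁻¹‖ * B k) := by
    intro k
    rw [integral_mul_symplFourier hℏ (hgint k), ← integral_mul_const]
    refine norm_integral_le_of_norm_le (φ.integrable.norm.mul_const _)
      (Filter.Eventually.of_forall fun w => ?_)
    rcases le_or_gt ‖w‖ (r + ε) with hw | hw
    · simp [hφ w hw]
    · rw [norm_mul, norm_mul]
      have hv : r / ℏ + ε / ℏ ≤ ‖-(ℏ⁻¹ • J n w)‖ := by
        rw [norm_neg, norm_smul, norm_J, norm_inv, Real.norm_of_nonneg hℏ.le, ← add_div,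
          div_eq_inv_mul]
        gcongr
      have h := norm_integral_gaussTwist_le hC (by positivity) hf hb (by positivity) hv
        (hδ0 k) (hδ1 k)
      simp only [hgauss]
      gcongr
  have hlim2 : Filter.Tendsto (fun k => ∫ z, g k z * symplFourier n hℏ φ z) Filter.atTop
      (nhds 0) := by
    refine squeeze_zero_norm hle ?_
    simpa using (hBlim.const_mul ‖(((2 * Real.pi * ℏ : ℝ) : ℂ) ^ n)⁻¹‖).const_mul (∫ w, ‖φ w‖)
  exact tendsto_nhds_unique hlim1 hlim2

/-! ### Fourier multipliers with Schwartz symbol -/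

theorem one_add_norm_le_mul {E : Type*} [NormedAddCommGroup E] {x y z : E} (h : ‖x‖ ≤ ‖y‖ + ‖z‖) :
    1 + ‖x‖ ≤ (1 + ‖y‖) * (1 + ‖z‖) := by
  nlinarith [norm_nonneg y, norm_nonneg z]

theorem integrable_one_add_norm_pow_mul {n : ℕ} (φ : 𝓢(Phase n, ℂ)) (N : ℕ) :
    Integrable fun w => (1 + ‖w‖) ^ N * ‖φ w‖ := by
  refine ((φ.integrable.norm.add (φ.integrable_pow_mul volume N)).const_mul (2 ^ (N - 1))).mono'
    (Continuous.aestronglyMeasurable (by fun_prop)) (Filter.Eventually.of_forall fun w => ?_)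
  rw [Real.norm_of_nonneg (by positivity)]
  have h := add_pow_le zero_le_one (norm_nonneg w) N
  calc (1 + ‖w‖) ^ N * ‖φ w‖ ≤ (2 ^ (N - 1) * (1 ^ N + ‖w‖ ^ N)) * ‖φ w‖ := by gcongr
    _ = _ := by simp; ring

theorem exists_norm_le_inv_pow {n : ℕ} (φ : 𝓢(Phase n, ℂ)) (P : ℕ) :
    ∃ K : ℝ, 0 ≤ K ∧ ∀ w, ‖φ w‖ ≤ K * ((1 + ‖w‖) ^ P)⁻¹ := by
  refine ⟨2 ^ P * (Finset.Iic (P, 0)).sup (fun m => SchwartzMap.seminorm ℝ m.1 m.2) φ,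
    by positivity, fun w => ?_⟩
  have h := SchwartzMap.one_add_le_sup_seminorm_apply (𝕜 := ℝ) (m := (P, 0)) le_rfl le_rfl φ w
  rw [norm_iteratedFDeriv_zero] at h
  rw [← div_eq_mul_inv, le_div_iff₀ (by positivity), mul_comm]
  exact h

/-- The convolution of `f` with the reflection of a Schwartz function `k`, over the real points
only: it is defined, and entire in `ζ`, even though `k` need not extend to `ℂ²ⁿ`. -/
def realConv {n : ℕ} (f : CPhase n → ℂ) (k : 𝓢(Phase n, ℂ)) (ζ : CPhase n) : ℂ :=
  ∫ w, f (ζ + toCPhase w) * k w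

/-- The spaces `A_r` are stable under real translations, uniformly up to a polynomial factor. -/
theorem norm_add_toCPhase_le {n : ℕ} {f : CPhase n → ℂ} {C ρ : ℝ} {N : ℕ} (hC : 0 < C)
    (hb : ∀ ζ, ‖f ζ‖ ≤ C * (1 + ‖ζ‖) ^ N * Real.exp (ρ * ‖imPart ζ‖)) (ζ : CPhase n)
    (w : Phase n) :
    ‖f (ζ + toCPhase w)‖ ≤
      C * (1 + ‖ζ‖) ^ N * Real.exp (ρ * ‖imPart ζ‖) * (1 + ‖w‖) ^ N := by
  have him : imPart (ζ + toCPhase w) = imPart ζ := by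
    ext j
    simp [imPart, toCPhase]
  have h1 : 1 + ‖ζ + toCPhase w‖ ≤ (1 + ‖ζ‖) * (1 + ‖w‖) := by
    rw [← norm_toCPhase w]
    exact one_add_norm_le_mul (norm_add_le _ _)
  calc ‖f (ζ + toCPhase w)‖
      ≤ C * (1 + ‖ζ + toCPhase w‖) ^ N * Real.exp (ρ * ‖imPart ζ‖) := him ▸ hb _
    _ ≤ C * ((1 + ‖ζ‖) * (1 + ‖w‖)) ^ N * Real.exp (ρ * ‖imPart ζ‖) := by gcongr
    _ = _ := by rw [mul_pow]; ring

theorem norm_realConv_le {n : ℕ} {f : CPhase n → ℂ} {C ρ : ℝ} {N : ℕ} (hC : 0 < C)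
    (hb : ∀ ζ, ‖f ζ‖ ≤ C * (1 + ‖ζ‖) ^ N * Real.exp (ρ * ‖imPart ζ‖)) (k : 𝓢(Phase n, ℂ))
    (ζ : CPhase n) :
    ‖realConv f k ζ‖ ≤ C * (∫ w, (1 + ‖w‖) ^ N * ‖k w‖) * (1 + ‖ζ‖) ^ N *
      Real.exp (ρ * ‖imPart ζ‖) := by
  rw [show C * (∫ w, (1 + ‖w‖) ^ N * ‖k w‖) * (1 + ‖ζ‖) ^ N * Real.exp (ρ * ‖imPart ζ‖) =
    (C * (1 + ‖ζ‖) ^ N * Real.exp (ρ * ‖imPart ζ‖)) * ∫ w, (1 + ‖w‖) ^ N * ‖k w‖ by ring,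
    ← integral_const_mul]
  refine norm_integral_le_of_norm_le ((integrable_one_add_norm_pow_mul k N).const_mul _)
    (Filter.Eventually.of_forall fun w => ?_)
  rw [norm_mul, ← mul_assoc]
  gcongr
  exact norm_add_toCPhase_le hC hb ζ w

theorem differentiable_realConv {n : ℕ} {f : CPhase n → ℂ} {C ρ : ℝ} {N : ℕ} (hC : 0 < C)
    (hρ : 0 ≤ ρ) (hf : Differentiable ℂ f)
    (hb : ∀ ζ, ‖f ζ‖ ≤ C * (1 + ‖ζ‖) ^ N * Real.exp (ρ * ‖imPart ζ‖)) (k : 𝓢(Phase n, ℂ)) :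
    Differentiable ℂ (realConv f k) := by
  have him : ∀ ζ : CPhase n, ‖imPart ζ‖ ≤ ‖ζ‖ := by
    intro ζ
    rw [EuclideanSpace.norm_eq, EuclideanSpace.norm_eq]
    refine Real.sqrt_le_sqrt (Finset.sum_le_sum fun j _ => ?_)
    have := Complex.abs_im_le_norm (ζ j)
    simp only [imPart, Real.norm_eq_abs]
    gcongr
  unfold realConv
  refine differentiable_integral_of_holomorphic (fun w => ?_) ?_ fun R => ?_
  · fun_prop
  · have h1 := hf.continuous
    have h2 := continuous_toCPhase (n := n)
    fun_prop
  · refine ⟨fun w => C * (1 + R) ^ N * Real.exp (ρ * R) * ((1 + ‖w‖) ^ N * ‖k w‖),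
      (integrable_one_add_norm_pow_mul k N).const_mul _, fun ζ hζ w => ?_⟩
    have hR : 0 ≤ R := (norm_nonneg ζ).trans hζ
    beta_reduce
    rw [norm_mul, ← mul_assoc]
    gcongr
    refine (norm_add_toCPhase_le hC hb ζ w).trans ?_
    gcongr
    exact (him ζ).trans hζ

theorem contDiff_comp_toCPhase {n : ℕ} {f : CPhase n → ℂ} (hf : Differentiable ℂ f) :
    ContDiff ℝ (⊤ : ℕ∞) fun z : Phase n => f (toCPhase z) := by
  have h1 : ContDiff ℝ (⊤ : ℕ∞) f := (contDiff_of_entire hf).restrict_scalars ℝ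
  have h2 : ContDiff ℝ (⊤ : ℕ∞) (toCPhase (n := n)) := by
    let L : Phase n →ₗ[ℝ] CPhase n :=
      { toFun := toCPhase
        map_add' := fun x y => by ext j; simp [toCPhase]
        map_smul' := fun c x => by ext j; simp [toCPhase] }
    exact L.toContinuousLinearMap.contDiff
  exact h1.comp h2

/-- The convolution theorem: `F_σ (m · F_σ φ)` is the convolution of `φ` and `F_σ m`. -/
theorem symplFourier_smul_symplFourier {n : ℕ} {ℏ : ℝ} (hℏ : 0 < ℏ) (m φ : 𝓢(Phase n, ℂ))
    (z : Phase n) :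
    symplFourier n hℏ (SchwartzMap.smulLeftCLM ℂ m (symplFourier n hℏ φ)) z =
      (((2 * Real.pi * ℏ : ℝ) : ℂ) ^ n)⁻¹ * ∫ u, φ u * symplFourier n hℏ m (z - u) := by
  have hg : Integrable fun w => m w * Complex.exp (-(Complex.I / ℏ) * sympl z w) := by
    refine m.integrable.mul_bdd (c := 1) ?_
      (Filter.Eventually.of_forall fun w => (norm_exp_sympl ℏ z w).le)
    have := continuous_sympl (n := n)
    exact Continuous.aestronglyMeasurable (by fun_prop)
  rw [symplFourier_apply]
  congr 1
  calc ∫ w, Complex.exp (-(Complex.I / ℏ) * sympl z w) *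
        SchwartzMap.smulLeftCLM ℂ m (symplFourier n hℏ φ) w
      = ∫ w, (m w * Complex.exp (-(Complex.I / ℏ) * sympl z w)) * symplFourier n hℏ φ w := by
        refine integral_congr_ae (Filter.Eventually.of_forall fun w => ?_)
        simp only [SchwartzMap.smulLeftCLM_apply_apply m.hasTemperateGrowth, smul_eq_mul]
        ring
    _ = _ := by
        rw [integral_mul_symplFourier hℏ hg]
        refine integral_congr_ae (Filter.Eventually.of_forall fun u => ?_)
        simp only [symplFourier_apply]
        congr 2
        refine integral_congr_ae (Filter.Eventually.of_forall fun w => ?_)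
        simp only
        rw [mul_assoc, ← Complex.exp_add, mul_comm]
        congr 2
        have h : sympl (z - u) w = sympl z w + sympl w u := by
          rw [sympl_swap w u, ← inner_J, ← inner_J, ← inner_J, map_sub, inner_sub_left]
          ring
        rw [h]
        push_cast
        ring

/-- Fourier multipliers with Schwartz symbol preserve the spaces `A_r`: they act by convolution
over the real points, which does not affect the growth in the imaginary directions. -/
theorem mem_expTypeSpace_of_multiplier {n : ℕ} {ℏ r : ℝ} (hℏ : 0 < ℏ) (hr : 0 ≤ r)
    {T S : 𝓢'(Phase n, ℂ)} (hT : T ∈ expTypeSpace n ℏ r) (m : 𝓢(Phase n, ℂ))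
    (hS : ∀ φ, S φ = T (symplFourier n hℏ (SchwartzMap.smulLeftCLM ℂ m (symplFourier n hℏ φ)))) :
    S ∈ expTypeSpace n ℏ r := by
  obtain ⟨a, ⟨hsm, f, hf, hfa, C, hC, N, hN, hb⟩, hTa⟩ := hT
  set k := symplFourier n hℏ m with hk
  set κ : ℂ := (((2 * Real.pi * ℏ : ℝ) : ℂ) ^ n)⁻¹ with hκ
  set g : CPhase n → ℂ := fun ζ => κ * realConv f k ζ with hg
  have hgd : Differentiable ℂ g :=
    (differentiable_realConv hC (by positivity) hf hb k).const_mul κ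
  have hI : 0 ≤ ∫ w, (1 + ‖w‖) ^ N * ‖k w‖ := integral_nonneg fun w => by positivity
  have hgE : IsExpType n ℏ r fun z => g (toCPhase z) := by
    -- The summand `1` makes the constant positive also where `k = 0`.
    refine ⟨contDiff_comp_toCPhase hgd, g, hgd, fun _ => rfl,
      ‖κ‖ * (C * ∫ w, (1 + ‖w‖) ^ N * ‖k w‖) + 1, by positivity, N, hN, fun ζ => ?_⟩
    rw [hg, norm_mul]
    calc ‖κ‖ * ‖realConv f k ζ‖ ≤ ‖κ‖ * (C * (∫ w, (1 + ‖w‖) ^ N * ‖k w‖) * (1 + ‖ζ‖) ^ N *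
          Real.exp (r / ℏ * ‖imPart ζ‖)) := by
          gcongr
          exact norm_realConv_le hC hb k ζ
      _ = (‖κ‖ * (C * ∫ w, (1 + ‖w‖) ^ N * ‖k w‖)) * (1 + ‖ζ‖) ^ N *
          Real.exp (r / ℏ * ‖imPart ζ‖) := by ring
      _ ≤ _ := by
          gcongr
          linarith
  obtain ⟨T', hT'⟩ := hgE.exists_isGivenBy
  refine ⟨_, hgE, fun φ => ⟨(hT' φ).1, ?_⟩⟩
  have hab : ∀ z, ‖a z‖ ≤ C * (1 + ‖z‖) ^ N := by
    intro z
    have h := hb (toCPhase z)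
    rwa [hfa, norm_toCPhase, show imPart (toCPhase z) = 0 by ext i; simp [imPart, toCPhase],
      norm_zero, mul_zero, Real.exp_zero, mul_one] at h
  have hint : Integrable (Function.uncurry fun z u : Phase n => a z * (κ * (φ u * k (z - u))))
      (volume.prod volume) := by
    obtain ⟨K, hK, hkb⟩ := exists_norm_le_inv_pow k (N + (2 * n + 1))
    have hdom := ((integrable_weight n).mul_prod
      (integrable_one_add_norm_pow_mul φ (N + (2 * n + 1)))).const_mul (C * (‖κ‖ * K))
    refine hdom.mono' ?_ (Filter.Eventually.of_forall fun p => ?_)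
    · have h1 := hsm.continuous
      exact Continuous.aestronglyMeasurable (by fun_prop)
    · obtain ⟨z, u⟩ := p
      simp only [Function.uncurry, norm_mul]
      have hz : (1 + ‖z‖) ^ (N + (2 * n + 1)) ≤
          (1 + ‖u‖) ^ (N + (2 * n + 1)) * (1 + ‖z - u‖) ^ (N + (2 * n + 1)) := by
        rw [← mul_pow]
        gcongr
        refine one_add_norm_le_mul ?_
        have := norm_add_le u (z - u)
        rwa [add_sub_cancel] at this
      have hk2 : ‖k (z - u)‖ ≤ K * ((1 + ‖u‖) ^ (N + (2 * n + 1)) *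
          ((1 + ‖z‖) ^ (N + (2 * n + 1)))⁻¹) := by
        refine (hkb _).trans ?_
        gcongr
        rw [← div_eq_mul_inv, le_div_iff₀ (by positivity), inv_mul_le_iff₀ (by positivity),
          mul_comm ((1 + ‖z - u‖) ^ _)]
        exact hz
      calc ‖a z‖ * (‖κ‖ * (‖φ u‖ * ‖k (z - u)‖))
          ≤ (C * (1 + ‖z‖) ^ N) * (‖κ‖ * (‖φ u‖ * (K * ((1 + ‖u‖) ^ (N + (2 * n + 1)) *
            ((1 + ‖z‖) ^ (N + (2 * n + 1)))⁻¹)))) := by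
            gcongr
            exact hab z
        _ = _ := by
            have : 1 + ‖z‖ ≠ 0 := by positivity
            field_simp
            ring
  calc S φ = ∫ z, ∫ u, a z * (κ * (φ u * k (z - u))) := by
        rw [hS, (hTa _).2]
        refine integral_congr_ae (Filter.Eventually.of_forall fun z => ?_)
        simp only [symplFourier_smul_symplFourier, ← integral_const_mul, hκ, hk]
    _ = ∫ u, ∫ z, a z * (κ * (φ u * k (z - u))) := integral_integral_swap hint
    _ = ∫ u, g (toCPhase u) * φ u := by
        refine integral_congr_ae (Filter.Eventually.of_forall fun u => ?_)
        simp only [hg, realConv]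
        rw [← integral_add_right_eq_self _ u, ← integral_const_mul, ← integral_mul_const]
        refine integral_congr_ae (Filter.Eventually.of_forall fun w => ?_)
        have h : toCPhase u + toCPhase w = toCPhase (w + u) := by
          ext j
          simp [toCPhase, add_comm]
        simp only [h, hfa, add_sub_cancel_right]
        ring

/-! ### Fourier inversion -/

/-- The isometry underlying the symplectic form, bundled. -/
def isometryJ (n : ℕ) : Phase n ≃ₗᵢ[ℝ] Phase n := ⟨J n, norm_J⟩

/-- The symplectic Fourier transform is an involution. -/
theorem symplFourier_symplFourier {n : ℕ} {ℏ : ℝ} (hℏ : 0 < ℏ) (φ : 𝓢(Phase n, ℂ)) :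
    symplFourier n hℏ (symplFourier n hℏ φ) = φ := by
  ext z
  have hc : (0 : ℝ) < 2 * Real.pi * ℏ := by positivity
  set c := 2 * Real.pi * ℏ with hcdef
  have hc' : ((c : ℂ) ^ n) ≠ 0 := pow_ne_zero _ (by exact_mod_cast hc.ne')
  set ψ : Phase n → ℂ := FourierTransform.fourier (φ : Phase n → ℂ) with hψ
  have happ : ∀ w, symplFourier n hℏ φ w = ((c : ℂ) ^ n)⁻¹ * ψ (c⁻¹ • J n w) := fun w => rfl
  have hinv : ∫ v, Complex.exp (2 * Real.pi * inner ℝ v z * Complex.I) * ψ v = φ z := by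
    have h : FourierTransformInv.fourierInv ψ z = φ z := by
      have h1 : FourierTransformInv.fourierInv (FourierTransform.fourier φ) z = φ z := by simp
      rw [SchwartzMap.fourierInv_coe, SchwartzMap.fourier_coe] at h1
      exact h1
    rw [Real.fourierInv_eq'] at h
    rw [← h]
    refine integral_congr_ae (Filter.Eventually.of_forall fun v => ?_)
    simp
  have hsub : ∀ G : Phase n → ℂ, ∫ w, G (c⁻¹ • J n w) = (c : ℂ) ^ n * (c : ℂ) ^ n * ∫ v, G v := by
    intro G
    have h1 : ∫ w, G (c⁻¹ • J n w) = ∫ y, G (c⁻¹ • y) :=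
      (isometryJ n).measurePreserving.integral_comp'
        (f := (isometryJ n).toHomeomorph.toMeasurableEquiv) fun y => G (c⁻¹ • y)
    rw [h1, Measure.integral_comp_smul]
    simp only [finrank_euclideanSpace, Fintype.card_sum, Fintype.card_fin, inv_pow, inv_inv,
      abs_of_pos (pow_pos hc _), Complex.real_smul]
    push_cast
    ring
  rw [symplFourier_apply, ← hcdef]
  have hint : ∫ w, Complex.exp (-(Complex.I / ℏ) * sympl z w) * symplFourier n hℏ φ w =
      ((c : ℂ) ^ n)⁻¹ * ∫ w, (fun v => Complex.exp (2 * Real.pi * inner ℝ v z * Complex.I) * ψ v)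
        (c⁻¹ • J n w) := by
    rw [← integral_const_mul]
    refine integral_congr_ae (Filter.Eventually.of_forall fun w => ?_)
    have h1 : (ℏ : ℂ) ≠ 0 := by exact_mod_cast hℏ.ne'
    have h2 : (Real.pi : ℂ) ≠ 0 := by exact_mod_cast Real.pi_ne_zero
    have h3 : -(Complex.I / ℏ) * sympl z w =
        2 * Real.pi * (inner ℝ (c⁻¹ • J n w) z : ℝ) * Complex.I := by
      rw [real_inner_smul_left, inner_J, sympl_swap z w, hcdef]
      push_cast
      field_simp
    simp only [happ, h3]
    ring
  rw [hint, hsub fun v => Complex.exp (2 * Real.pi * inner ℝ v z * Complex.I) * ψ v, hinv]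
  field_simp

/-! ### The Born–Jordan map as a Fourier multiplier -/

theorem bornJordanToWeyl_apply {n : ℕ} {ℏ : ℝ} (hℏ : 0 < ℏ) (T : 𝓢'(Phase n, ℂ))
    (φ : 𝓢(Phase n, ℂ)) :
    bornJordanToWeyl n hℏ T φ =
      T (symplFourier n hℏ (SchwartzMap.smulLeftCLM ℂ (theta n ℏ) (symplFourier n hℏ φ))) := by
  have hc : (((2 * Real.pi * ℏ : ℝ) : ℂ) ^ n) ≠ 0 := by
    have : (0 : ℝ) < 2 * Real.pi * ℏ := by positivity
    exact pow_ne_zero _ (by exact_mod_cast this.ne')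
  have h : bornJordanToWeyl n hℏ T φ =
      (((2 * Real.pi * ℏ : ℝ) : ℂ) ^ n)⁻¹ * conv T (thetaSigma n hℏ) φ := rfl
  rw [h, conv_apply T _ (thetaSigma_isConvolutorBy n hℏ)]
  simp only [smul_apply, map_smul, smul_eq_mul, inv_mul_cancel_left₀ hc]
  rfl

/-- The pairing of `T ∈ A_r` with `F_σ ψ` depends only on the values of `ψ` near the closed ball of
radius `r`. -/
theorem apply_symplFourier_congr {n : ℕ} {ℏ r : ℝ} (hℏ : 0 < ℏ) (hr : 0 ≤ r) {T : 𝓢'(Phase n, ℂ)}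
    (hT : T ∈ expTypeSpace n ℏ r) {ε : ℝ} (hε : 0 < ε) {ψ₁ ψ₂ : 𝓢(Phase n, ℂ)}
    (h : ∀ w, ‖w‖ ≤ r + ε → ψ₁ w = ψ₂ w) :
    T (symplFourier n hℏ ψ₁) = T (symplFourier n hℏ ψ₂) := by
  obtain ⟨a, ha, hTa⟩ := hT
  have h0 : T (symplFourier n hℏ (ψ₁ - ψ₂)) = 0 := by
    rw [(hTa _).2]
    exact integral_mul_symplFourier_eq_zero hℏ hr ha hε (fun w hw => by simp [h w hw]) (hTa _).1
  rwa [map_sub, map_sub, sub_eq_zero] at h0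

theorem theta_ne_zero {n : ℕ} {ℏ : ℝ} (hℏ : 0 < ℏ) {z : Phase n}
    (hz : ‖z‖ ^ 2 < 4 * Real.pi * ℏ) : theta n ℏ z ≠ 0 := by
  have h1 : 2 * |posDotMom z| ≤ ‖z‖ ^ 2 := by
    have h2 : ‖z‖ ^ 2 = ∑ i, (z (Sum.inl i) ^ 2 + z (Sum.inr i) ^ 2) := by
      simp [EuclideanSpace.norm_sq_eq, Fintype.sum_sum_type, Finset.sum_add_distrib]
    have h3 : |posDotMom z| ≤ ∑ i, |z (Sum.inl i) * z (Sum.inr i)| :=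
      Finset.abs_sum_le_sum_abs _ _
    have h4 : 2 * ∑ i, |z (Sum.inl i) * z (Sum.inr i)| ≤ ‖z‖ ^ 2 := by
      rw [h2, Finset.mul_sum]
      refine Finset.sum_le_sum fun i _ => ?_
      rw [abs_mul, ← sq_abs (z (Sum.inl i)), ← sq_abs (z (Sum.inr i))]
      nlinarith [sq_nonneg (|z (Sum.inl i)| - |z (Sum.inr i)|)]
    linarith
  have h5 : |posDotMom z / (2 * ℏ)| < Real.pi := by
    rw [abs_div, abs_of_pos (by positivity : 0 < 2 * ℏ), div_lt_iff₀ (by positivity)]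
    linarith
  rw [theta, Complex.ofReal_ne_zero]
  generalize posDotMom z / (2 * ℏ) = y at h5
  rcases eq_or_ne y 0 with rfl | hy
  · simp
  · rw [Real.sinc_of_ne_zero hy]
    refine div_ne_zero (fun hs => hy ?_) hy
    exact (Real.sin_eq_zero_iff_of_lt_of_lt (abs_lt.1 h5).1 (abs_lt.1 h5).2).1 hs

/-- Truncation of a function that is smooth on a neighbourhood of a ball to a Schwartz function. -/
theorem exists_schwartz_eqOn_ball {n : ℕ} {h : Phase n → ℂ} {R₁ R₂ : ℝ} (h0 : 0 < R₁)
    (h12 : R₁ < R₂) (hh : ∀ z, ‖z‖ ≤ R₂ → ContDiffAt ℝ (⊤ : ℕ∞) h z) :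
    ∃ m : 𝓢(Phase n, ℂ), ∀ z, ‖z‖ ≤ R₁ → m z = h z := by
  let χ : ContDiffBump (0 : Phase n) := ⟨R₁, R₂, h0, h12⟩
  have hcs : HasCompactSupport fun z => (χ z : ℂ) * h z := by
    have h1 : HasCompactSupport fun z => (χ z : ℂ) :=
      χ.hasCompactSupport.comp_left (g := Complex.ofReal) Complex.ofReal_zero
    exact h1.mul_right
  have hχ : ContDiff ℝ (⊤ : ℕ∞) fun z => (χ z : ℂ) :=
    Complex.ofRealCLM.contDiff.comp (χ.contDiff (n := ⊤))
  have hsm : ContDiff ℝ (⊤ : ℕ∞) fun z => (χ z : ℂ) * h z := by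
    refine contDiff_iff_contDiffAt.2 fun z => ?_
    rcases le_or_gt ‖z‖ R₂ with hz | hz
    · exact hχ.contDiffAt.mul (hh z hz)
    · refine (contDiffAt_const (c := (0 : ℂ))).congr_of_eventuallyEq ?_
      filter_upwards [(isOpen_lt continuous_const continuous_norm).mem_nhds hz] with y hy
      rw [χ.zero_of_le_dist (by simpa using le_of_lt hy), Complex.ofReal_zero, zero_mul]
  refine ⟨hcs.toSchwartzMap hsm, fun z hz => ?_⟩
  rw [HasCompactSupport.toSchwartzMap_toFun,
    χ.one_of_mem_closedBall (by simpa using hz), Complex.ofReal_one, one_mul]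

theorem bornJordanToWeyl_mapsTo {n : ℕ} {ℏ r : ℝ} (hℏ : 0 < ℏ) (hr : 0 ≤ r) :
    Set.MapsTo (bornJordanToWeyl n hℏ) (expTypeSpace n ℏ r) (expTypeSpace n ℏ r) := by
  intro T hT
  obtain ⟨m, hm⟩ := exists_schwartz_eqOn_ball (h := theta n ℏ) (R₁ := r + 1) (R₂ := r + 2)
    (by linarith) (by linarith) fun z _ => (theta_temperate n ℏ).1.contDiffAt
  refine mem_expTypeSpace_of_multiplier hℏ hr hT m fun φ => ?_
  rw [bornJordanToWeyl_apply]
  refine apply_symplFourier_congr hℏ hr hT one_pos fun w hw => ?_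
  rw [SchwartzMap.smulLeftCLM_apply_apply (theta_temperate n ℏ),
    SchwartzMap.smulLeftCLM_apply_apply m.hasTemperateGrowth, hm w hw]

/-- Below the critical radius `Θ` has an inverse on a neighbourhood of the closed ball of radius
`r`, which can be truncated to a Schwartz function. -/
theorem exists_schwartz_mul_theta_eq_one {n : ℕ} {ℏ r : ℝ} (hℏ : 0 < ℏ) (hr : 0 ≤ r)
    (hlt : r < Real.sqrt (4 * Real.pi * ℏ)) :
    ∃ ε > 0, ∃ m : 𝓢(Phase n, ℂ), ∀ z, ‖z‖ ≤ r + ε → m z * theta n ℏ z = 1 := by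
  set R := Real.sqrt (4 * Real.pi * ℏ) with hR
  have hne : ∀ z : Phase n, ‖z‖ < R → theta n ℏ z ≠ 0 := by
    intro z hz
    refine theta_ne_zero hℏ ?_
    rwa [hR, Real.lt_sqrt (norm_nonneg z)] at hz
  obtain ⟨m, hm⟩ := exists_schwartz_eqOn_ball (h := fun z => (theta n ℏ z)⁻¹)
    (R₁ := r + (R - r) / 3) (R₂ := r + (R - r) / 2) (by linarith) (by linarith) fun z hz =>
      (theta_temperate n ℏ).1.contDiffAt.inv (hne z (by linarith))
  exact ⟨(R - r) / 3, by linarith, m, fun z hz => by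
    rw [hm z hz, inv_mul_cancel₀ (hne z (by linarith))]⟩

theorem bornJordanToWeyl_bijOn {n : ℕ} {ℏ r : ℝ} (hℏ : 0 < ℏ) (hr : 0 ≤ r)
    (hlt : r < Real.sqrt (4 * Real.pi * ℏ)) :
    Set.BijOn (bornJordanToWeyl n hℏ) (expTypeSpace n ℏ r) (expTypeSpace n ℏ r) := by
  obtain ⟨ε, hε, m, hm⟩ := exists_schwartz_mul_theta_eq_one (n := n) hℏ hr hlt
  have hmt := m.hasTemperateGrowth
  have hθt := theta_temperate n ℏ
  set Q : 𝓢(Phase n, ℂ) →L[ℂ] 𝓢(Phase n, ℂ) :=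
    symplFourier n hℏ ∘L SchwartzMap.smulLeftCLM ℂ m ∘L symplFourier n hℏ with hQ
  have hQa : ∀ φ, Q φ = symplFourier n hℏ (SchwartzMap.smulLeftCLM ℂ m (symplFourier n hℏ φ)) :=
    fun φ => rfl
  -- `Q` is a two-sided inverse of the transposed map, when tested against elements of `A_r`.
  have hleft : ∀ T ∈ expTypeSpace n ℏ r, ∀ φ, bornJordanToWeyl n hℏ T (Q φ) = T φ := by
    intro T hT φ
    rw [bornJordanToWeyl_apply, hQa, symplFourier_symplFourier]
    conv_rhs => rw [← symplFourier_symplFourier hℏ φ]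
    refine apply_symplFourier_congr hℏ hr hT hε fun w hw => ?_
    rw [SchwartzMap.smulLeftCLM_apply_apply hθt, SchwartzMap.smulLeftCLM_apply_apply hmt,
      smul_eq_mul, smul_eq_mul, ← mul_assoc, mul_comm (theta n ℏ w), hm w hw, one_mul]
  refine ⟨bornJordanToWeyl_mapsTo hℏ hr, fun T hT S hS hTS => ?_, fun T hT => ?_⟩
  · ext φ
    rw [← hleft T hT, ← hleft S hS, hTS]
  · refine ⟨PointwiseConvergenceCLM.precomp ℂ Q T,
      mem_expTypeSpace_of_multiplier hℏ hr hT m fun φ => rfl, ?_⟩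
    ext φ
    rw [bornJordanToWeyl_apply]
    change T (Q _) = T φ
    rw [hQa, symplFourier_symplFourier]
    conv_rhs => rw [← symplFourier_symplFourier hℏ φ]
    refine apply_symplFourier_congr hℏ hr hT hε fun w hw => ?_
    rw [SchwartzMap.smulLeftCLM_apply_apply hmt, SchwartzMap.smulLeftCLM_apply_apply hθt,
      smul_eq_mul, smul_eq_mul, ← mul_assoc, hm w hw, one_mul]

/-! ### Failure of injectivity from the critical radius on -/

/-- Plane waves with frequency in the closed ball of radius `r` belong to `A_r`. -/
theorem isExpType_planeWave {n : ℕ} {ℏ r : ℝ} (hℏ : 0 < ℏ) {z₀ : Phase n} (hz : ‖z₀‖ ≤ r) :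
    IsExpType n ℏ r fun z => Complex.exp (-(Complex.I / ℏ) * sympl z₀ z) := by
  have hf : Differentiable ℂ fun ζ : CPhase n =>
      Complex.exp (-(Complex.I / ℏ) * cdot (J n z₀) ζ) :=
    ((differentiable_cdot _).const_mul _).cexp
  have hext : ∀ z, Complex.exp (-(Complex.I / ℏ) * cdot (J n z₀) (toCPhase z)) =
      Complex.exp (-(Complex.I / ℏ) * sympl z₀ z) := fun z => by rw [cdot_toCPhase, inner_J]
  have hsm := contDiff_comp_toCPhase hf
  simp only [hext] at hsm
  refine ⟨hsm, _, hf, hext, 1, one_pos, 1, one_pos, fun ζ => ?_⟩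
  have hre : (-(Complex.I / ℏ) * cdot (J n z₀) ζ).re = ℏ⁻¹ * inner ℝ (J n z₀) (imPart ζ) := by
    rw [← im_cdot, show -(Complex.I / ℏ) * cdot (J n z₀) ζ =
      ((ℏ⁻¹ : ℝ) : ℂ) * (-Complex.I * cdot (J n z₀) ζ) by push_cast; ring, Complex.re_ofReal_mul]
    simp
  have hin : ℏ⁻¹ * inner ℝ (J n z₀) (imPart ζ) ≤ r / ℏ * ‖imPart ζ‖ := by
    have h1 := real_inner_le_norm (J n z₀) (imPart ζ)
    rw [norm_J] at h1
    rw [div_eq_inv_mul, mul_assoc]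
    gcongr
    exact h1.trans (by gcongr)
  rw [Complex.norm_exp, hre, one_mul, pow_one]
  calc Real.exp (ℏ⁻¹ * inner ℝ (J n z₀) (imPart ζ)) ≤ 1 * Real.exp (r / ℏ * ‖imPart ζ‖) := by
        rw [one_mul]
        gcongr
    _ ≤ _ := by
        gcongr
        linarith [norm_nonneg ζ]

/-- At the critical radius the zero set `x · p = 2πℏ` of `Θ` touches the sphere, at points with
`x = p`. -/
theorem exists_theta_eq_zero {n : ℕ} (hn : 1 ≤ n) {ℏ : ℝ} (hℏ : 0 < ℏ) :
    ∃ z₀ : Phase n, ‖z₀‖ = Real.sqrt (4 * Real.pi * ℏ) ∧ theta n ℏ z₀ = 0 := by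
  let i₀ : Fin n := ⟨0, hn⟩
  set s := Real.sqrt (2 * Real.pi * ℏ) with hs
  have hss : s * s = 2 * Real.pi * ℏ := Real.mul_self_sqrt (by positivity)
  let e : Fin n → ℝ := Pi.single i₀ s
  have he : ∑ i, e i * e i = s * s := by
    simp [e, Pi.single_apply]
  refine ⟨WithLp.toLp 2 (Sum.elim e e), ?_, ?_⟩
  · rw [EuclideanSpace.norm_eq]
    congr 1
    simp only [Fintype.sum_sum_type, Sum.elim_inl, Sum.elim_inr, Real.norm_eq_abs, sq_abs]
    simp only [sq, he, hss]
    ring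
  · have h1 : posDotMom (WithLp.toLp 2 (Sum.elim e e) : Phase n) / (2 * ℏ) = Real.pi := by
      simp only [posDotMom, Sum.elim_inl, Sum.elim_inr, he, hss]
      field_simp
    rw [theta, h1, Real.sinc_of_ne_zero Real.pi_ne_zero, Real.sin_pi, zero_div, Complex.ofReal_zero]

theorem not_injOn_bornJordanToWeyl {n : ℕ} (hn : 1 ≤ n) {ℏ r : ℝ} (hℏ : 0 < ℏ)
    (hle : Real.sqrt (4 * Real.pi * ℏ) ≤ r) :
    ¬ Set.InjOn (bornJordanToWeyl n hℏ) (expTypeSpace n ℏ r) := by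
  intro hinj
  obtain ⟨z₀, hz₀, hθ⟩ := exists_theta_eq_zero hn hℏ
  have hc : (((2 * Real.pi * ℏ : ℝ) : ℂ) ^ n) ≠ 0 := by
    have : (0 : ℝ) < 2 * Real.pi * ℏ := by positivity
    exact pow_ne_zero _ (by exact_mod_cast this.ne')
  have hE := isExpType_planeWave hℏ (hz₀.trans_le hle)
  obtain ⟨T, hT⟩ := hE.exists_isGivenBy
  have hTapp : ∀ φ, T φ = ((2 * Real.pi * ℏ : ℝ) : ℂ) ^ n * symplFourier n hℏ φ z₀ := by
    intro φ
    rw [(hT φ).2, symplFourier_apply, mul_inv_cancel_left₀ hc]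
  have h0 : (0 : 𝓢'(Phase n, ℂ)) ∈ expTypeSpace n ℏ r := by
    refine ⟨fun _ => 0, ⟨contDiff_const, fun _ => 0, differentiable_const _, fun _ => rfl, 1,
      one_pos, 1, one_pos, fun ζ => ?_⟩, fun φ => ?_⟩
    · rw [norm_zero]
      positivity
    · simp
  have hker : bornJordanToWeyl n hℏ T = bornJordanToWeyl n hℏ 0 := by
    ext φ
    rw [bornJordanToWeyl_apply, bornJordanToWeyl_apply, hTapp, symplFourier_symplFourier,
      SchwartzMap.smulLeftCLM_apply_apply (theta_temperate n ℏ), hθ, zero_smul, mul_zero]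
    rfl
  have hT0 : T = 0 := hinj ⟨_, hE, hT⟩ h0 hker
  obtain ⟨m, hm⟩ := exists_schwartz_eqOn_ball (n := n) (h := fun _ => 1) (R₁ := ‖z₀‖ + 1)
    (R₂ := ‖z₀‖ + 2) (by positivity) (by linarith) fun z _ => contDiffAt_const
  have h1 := hTapp (symplFourier n hℏ m)
  rw [symplFourier_symplFourier, hm z₀ (by linarith), mul_one, hT0] at h1
  exact hc h1.symm

end BornJordan

end

theorem proposition5p5 (n : ℕ) (hn : 1 ≤ n) (ℏ : ℝ) (hℏ : 0 < ℏ) (r : ℝ) (hr : 0 ≤ r) :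
    Set.MapsTo (BornJordan.bornJordanToWeyl n hℏ)
      (BornJordan.expTypeSpace n ℏ r) (BornJordan.expTypeSpace n ℏ r) ∧
    (Set.BijOn (BornJordan.bornJordanToWeyl n hℏ)
      (BornJordan.expTypeSpace n ℏ r) (BornJordan.expTypeSpace n ℏ r) ↔
        r < Real.sqrt (4 * Real.pi * ℏ)) ∧
    (Real.sqrt (4 * Real.pi * ℏ) ≤ r →
      ¬ Set.InjOn (BornJordan.bornJordanToWeyl n hℏ) (BornJordan.expTypeSpace n ℏ r)) := by
  refine ⟨BornJordan.bornJordanToWeyl_mapsTo hℏ hr, ⟨fun h => ?_,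
    BornJordan.bornJordanToWeyl_bijOn hℏ hr⟩, BornJordan.not_injOn_bornJordanToWeyl hn hℏ⟩
  by_contra hle
  exact BornJordan.not_injOn_bornJordanToWeyl hn hℏ (not_lt.1 hle) h.injOn
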